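/- **Hypergraphs.** Fix a countable set $\Sigma$ of selectors and two distinct selectors $\mathbf{s},\mathbf{t}\in\Sigma$. A $\Sigma$-typed alphabet is a set $C$ with a function assigning to each $c\in C$ a finite set $\mathrm{type}(c)\subseteq\Sigma$. A hypergraph $H$ over $C$ consists of a finite set $V_H$ of nodes, a finite set $E_H$ of hyperedges, a labelling $\mathit{lab}_H:E_H\to C$, attachment functions $\mathit{att}_H(e):\mathrm{type}(\mathit{lab}_H(e))\to V_H$ for $e\in E_H$, and a function $\mathit{ext}_H:\mathrm{type}(H)\to V_H$ with $\mathrm{type}(H)\subseteq\Sigma$. Write $\mathrm{type}(e)$ for $\mathrm{type}(\mathit{lab}_H(e))$ and $|H|=|V_H|+|E_H|$. Hypergraphs are considered up to isomorphism. If $\mathrm{type}(e)=\mathrm{type}(K)$, then $H[e/K]$ is obtained from $H$ by removing $e$, adding a disjoint copy of $K$ and gluing $\mathit{att}_H(e)(\sigma)$ with $\mathit{ext}_K(\sigma)$ for each $\sigma\in\mathrm{type}(e)$; its external nodes are those of $H$. **Systems.** An ht-rule is a pair $r=(H\to H')$ of hypergraphs with $\mathrm{type}(H)=\mathrm{type}(H')$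 and with $\mathit{ext}_H,\mathit{ext}_{H'}$ injective. Write $G\Rightarrow_r G'$ if $G=K[e/H]$ and $G'=K[e/H']$ for some hypergraph $K$ and some $e\in E_K$ with $\mathit{att}_K(e)$ injective (the label of $e$ may be any symbol of type $\mathrm{type}(H)$). An ht-system $\mathcal G=\langle N,T,P,S\rangle$ consists of finite $\Sigma$-typed alphabets $N,T$, a finite set $P$ of ht-rules over $N\cup T$, and a hypergraph $S$ over $N\cup T$ with $\mathit{ext}_S$ injective. Its language $L(\mathcal G)$ is the set of hypergraphs $H$ over $T$ that can be derived from $S$ by finitely many steps $\Rightarrow_r$, $r\in P$. The system is linear-time if there is $c\in\mathbb N$ such that each $H\in L(\mathcal G)$ has a derivation from $S$ with at most $c\cdot|H|$ steps. **String graphs.** For a string $w=a_1\dots a_n$ of symbols of type $\{\mathbf s,\mathbf t\}$, the string graph $\mathrm{sg}(w)$ has nodes $v_0,\dots,v_n$ and hyperedges $e_1,\dots,e_n$, where $e_i$ is labelled $a_i$ and attached to $v_{i-1}$ by $\mathbf s$ and to $v_i$ by $\mathbf t$; its type is $\{\mathbf s,\mathbf t\}$, with $\mathit{ext}(\mathbf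 s)=v_0$ and $\mathit{ext}(\mathbf t)=v_n$. **String MILL1 grammars.** First-order multiplicative intuitionistic linear logic $\mathrm{MILL}1$ has formulae built from atoms $p(x_1,\dots,x_n)$ (with $p$ one of countably infinitely many predicate symbols of each arity and $x_i$ variables from a countably infinite set; no constants or function symbols) by $\otimes,\multimap,\exists,\forall$; formulae are identified up to renaming of bound variables. Its sequents $\Gamma\vdash B$ (with $\Gamma$ a finite, possibly empty, multiset of formulae) are derived from the axioms $A\vdash A$ by the usual left and right rules of intuitionistic linear logic for these connectives and quantifiers (without weakening and contraction). Fix two distinct variables, again denoted $\mathbf s,\mathbf t$. A string $\mathrm{MILL}1$ grammar is a triple $\langle T,S,\triangleright\rangle$ where $T$ is a finite alphabet, $S$ is a formula with free variables in $\{\mathbf s,\mathbf t\}$, and $\triangleright$ is a finite binary relation between $T$ and formulae such that $a\triangleright A$ implies that the free variables of $A$ are in $\{\mathbf s,\mathbf t\}$. It generates the set of all strings $a_1\dots a_n\in T^*$ for which there are formulae $A_1,\dots,A_n$ with $a_i\triangleright A_i$ such that $$A_1[x_0/\mathbf s,x_1/\mathbf t],\dots,A_n[x_{n-1}/\mathbf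 s,x_n/\mathbf t]\vdash S[x_0/\mathbf s,x_n/\mathbf t]$$ is derivable in $\mathrm{MILL}1$, where $x_0,\dots,x_n$ are distinct variables. **Corollary.** Let $\mathcal G=\langle N,T,P,S\rangle$ be a linear-time ht-system. Then the string language $$\{w\in T^+\mid \text{all symbols of } w \text{ have type } \{\mathbf s,\mathbf t\} \text{ and } \mathrm{sg}(w)\in L(\mathcal G)\}$$ is generated by a string $\mathrm{MILL}1$ grammar. -/

import Mathlib

/-! ## Hypergraphs and hypergraph transformation systems -/

section Hypergraphs

universe u v

variable {Sel : Type u} {C : Type v}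

/-- A hypergraph over the typed alphabet `C`, where `ty c` is the set of selectors of the label `c`.
Nodes and hyperedges form finite sets; `type` is the domain of the function `ext` that marks the
external nodes. -/
structure HGraph (ty : C → Set Sel) where
  V : Type
  E : Type
  finite_V : Finite V
  finite_E : Finite E
  lab : E → C
  att : (e : E) → ty (lab e) → V
  type : Set Sel
  ext : type → V

namespace HGraph

variable {ty : C → Set Sel}

/-- The number of nodes plus the number of hyperedges. -/
noncomputable def size (H : HGraph ty) : ℕ := Nat.card H.V + Nat.card H.E

/-- All hyperedge labels of `H` belong to `A`, that is, `H` is a hypergraph over `A ⊆ C`. -/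
def IsOver (H : HGraph ty) (A : Set C) : Prop := ∀ e, H.lab e ∈ A

/-- Isomorphism of hypergraphs: it preserves labels, attachments, the type and external nodes. -/
def Iso (H K : HGraph ty) : Prop :=
  ∃ (fV : H.V ≃ K.V) (fE : H.E ≃ K.E),
    (∀ e, K.lab (fE e) = H.lab e) ∧
    (∀ (e : H.E) (σ : Sel) (h : σ ∈ ty (H.lab e)) (h' : σ ∈ ty (K.lab (fE e))),
      K.att (fE e) ⟨σ, h'⟩ = fV (H.att e ⟨σ, h⟩)) ∧
    H.type = K.type ∧
    (∀ (σ : Sel) (h : σ ∈ H.type) (h' : σ ∈ K.type), K.ext ⟨σ, h'⟩ = fV (H.ext ⟨σ, h⟩))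

/-- `H / R`: the nodes are identified along the equivalence relation generated by `R`
(`Quot R` is the quotient by that equivalence relation). -/
def quotient (H : HGraph ty) (R : H.V → H.V → Prop) : HGraph ty where
  V := Quot R
  E := H.E
  finite_V := haveI := H.finite_V; Finite.of_surjective (Quot.mk R) Quot.mk_surjective
  finite_E := H.finite_E
  lab := H.lab
  att := fun e σ => Quot.mk R (H.att e σ)
  type := H.type
  ext := fun σ => Quot.mk R (H.ext σ)

/-- Remove the hyperedge `e` from `H` and add a disjoint copy of `K`; the external nodes are
those of `H`. -/
def removeAdd (H : HGraph ty) (e : H.E) (K : HGraph ty) : HGraph ty where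
  V := H.V ⊕ K.V
  E := {f : H.E // f ≠ e} ⊕ K.E
  finite_V := haveI := H.finite_V; haveI := K.finite_V; inferInstance
  finite_E := haveI := H.finite_E; haveI := K.finite_E; inferInstance
  lab := fun f => match f with
    | Sum.inl f => H.lab f.1
    | Sum.inr f => K.lab f
  att := fun f => match f with
    | Sum.inl f => fun σ => Sum.inl (H.att f.1 σ)
    | Sum.inr f => fun σ => Sum.inr (K.att f σ)
  type := H.type
  ext := fun σ => Sum.inl (H.ext σ)

/-- Hyperedge replacement `H[e/K]`, for `type(e) = type(K)`: after removing `e` and adding `K`,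
the node `att_H(e)(σ)` is glued with `ext_K(σ)` for each `σ ∈ type(e)`. -/
def replace (H : HGraph ty) (e : H.E) (K : HGraph ty)
    (h : ty (H.lab e) = K.type) : HGraph ty :=
  (H.removeAdd e K).quotient fun v w =>
    ∃ σ : ty (H.lab e), v = Sum.inl (H.att e σ) ∧ w = Sum.inr (K.ext ⟨σ.1, h ▸ σ.2⟩)

/-- The alphabet `C` extended by one fresh label `none` of type `X`. -/
def extTy (ty : C → Set Sel) (X : Set Sel) : Option C → Set Sel
  | none => X
  | some c => ty c

/-- `H` regarded as a hypergraph over the extended alphabet. -/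
def lift (X : Set Sel) (H : HGraph ty) : HGraph (extTy ty X) where
  V := H.V
  E := H.E
  finite_V := H.finite_V
  finite_E := H.finite_E
  lab := fun e => some (H.lab e)
  att := fun e σ => H.att e σ
  type := H.type
  ext := H.ext

open Classical in
/-- The string graph `sg(a₁…aₙ)`, for symbols `aᵢ` of type `{s, t}`: nodes `v₀, …, vₙ`, a hyperedge
labelled `aᵢ` from `vᵢ₋₁` (selector `s`) to `vᵢ` (selector `t`), external nodes `v₀` (selector `s`)
and `vₙ` (selector `t`). -/
noncomputable def sg (ty : C → Set Sel) (s t : Sel) (w : List C)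
    (_hw : ∀ a ∈ w, ty a = {s, t}) : HGraph ty where
  V := Fin (w.length + 1)
  E := Fin w.length
  finite_V := inferInstance
  finite_E := inferInstance
  lab := fun i => w.get i
  att := fun i σ => if σ.1 = s then i.castSucc else i.succ
  type := {s, t}
  ext := fun σ => if σ.1 = s then 0 else Fin.last w.length

end HGraph

/-- A hypergraph transformation rule `lhs → rhs`. -/
structure HTRule (ty : C → Set Sel) where
  lhs : HGraph ty
  rhs : HGraph ty
  type_eq : lhs.type = rhs.type
  lhs_inj : Function.Injective lhs.ext
  rhs_inj : Function.Injective rhs.ext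

/-- `G ⇒ᵣ G'`: up to isomorphism, `G = K[e/lhs]` and `G' = K[e/rhs]` for a hypergraph `K` and a
hyperedge `e` of `K` with injective attachment. The hyperedge `e` only marks a place in `K` and its
type is that of the rule, so that `K` may use a label of this type outside of `C`. -/
def HTRule.Step {ty : C → Set Sel} (r : HTRule ty) (G G' : HGraph ty) : Prop :=
  ∃ (K : HGraph (HGraph.extTy ty r.lhs.type)) (e : K.E)
    (h : HGraph.extTy ty r.lhs.type (K.lab e) = r.lhs.type),
    Function.Injective (K.att e) ∧
    (G.lift r.lhs.type).Iso (K.replace e (r.lhs.lift r.lhs.type) h) ∧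
    (G'.lift r.lhs.type).Iso (K.replace e (r.rhs.lift r.lhs.type) (h.trans r.type_eq))

/-- A hypergraph transformation system `⟨N, T, P, S⟩`; `N` and `T` are finite sets of symbols from
the typed set `C`. -/
structure HTSystem (ty : C → Set Sel) where
  N : Set C
  T : Set C
  finite_N : N.Finite
  finite_T : T.Finite
  P : Set (HTRule ty)
  finite_P : P.Finite
  P_over : ∀ r ∈ P, r.lhs.IsOver (N ∪ T) ∧ r.rhs.IsOver (N ∪ T)
  S : HGraph ty
  S_over : S.IsOver (N ∪ T)
  S_inj : Function.Injective S.ext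

namespace HTSystem

variable {ty : C → Set Sel}

/-- `G.DerivesIn n H H'`: there is a derivation of `H'` (up to isomorphism) from `H` with
exactly `n` steps. -/
inductive DerivesIn (G : HTSystem ty) : ℕ → HGraph ty → HGraph ty → Prop
  | refl {H H' : HGraph ty} : H.Iso H' → DerivesIn G 0 H H'
  | step {n : ℕ} {H H' H'' : HGraph ty} {r : HTRule ty} :
      DerivesIn G n H H' → r ∈ G.P → r.Step H' H'' → DerivesIn G (n + 1) H H''

/-- The language generated by `G`: hypergraphs over `T` derivable from the start hypergraph. -/
def language (G : HTSystem ty) : Set (HGraph ty) :=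
  {H | H.IsOver G.T ∧ ∃ n, G.DerivesIn n G.S H}

/-- `G` is linear-time: for some time constant `c`, each `H` in the language has a derivation with
at most `c · |H|` steps. -/
def IsLinearTime (G : HTSystem ty) : Prop :=
  ∃ c : ℕ, ∀ H ∈ G.language, ∃ n ≤ c * H.size, G.DerivesIn n G.S H

end HTSystem

end Hypergraphs

/-! ## First-order multiplicative intuitionistic linear logic -/

namespace MILL1

/-- Predicate symbols: countably many of each arity. -/
structure PredSymbol where
  name : ℕ
  arity : ℕ

/-- Formulae of MILL1 up to renaming of bound variables, in de Bruijn notation. The set of variables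
is `ℕ`. In the body of a quantifier, `0` is the variable bound by this quantifier, and `n + 1` is the
variable that is denoted by `n` outside of the quantifier. Hence a number `k` below `m` quantifiers
stands for the free variable `k - m` if `m ≤ k`, and for a bound variable otherwise. -/
inductive Formula : Type
  | atom (p : PredSymbol) (args : Fin p.arity → ℕ) : Formula
  | tensor (A B : Formula) : Formula
  | lolli (A B : Formula) : Formula
  | all (A : Formula) : Formula
  | ex (A : Formula) : Formula

namespace Formula

/-- The set of free variables. -/
def fvar : Formula → Set ℕ
  | atom _ args => Set.range args
  | tensor A B => A.fvar ∪ B.fvar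
  | lolli A B => A.fvar ∪ B.fvar
  | all A => {n | n + 1 ∈ A.fvar}
  | ex A => {n | n + 1 ∈ A.fvar}

/-- Extension of a variable substitution to the scope of a quantifier. -/
def liftSubst (h : ℕ → ℕ) : ℕ → ℕ
  | 0 => 0
  | n + 1 => h n + 1

/-- `A.subst h` is `A[h]`: the simultaneous capture-avoiding substitution of the variable `h x` for
each free variable `x`. -/
def subst : Formula → (ℕ → ℕ) → Formula
  | atom p args, h => atom p (fun i => h (args i))
  | tensor A B, h => tensor (A.subst h) (B.subst h)
  | lolli A B, h => lolli (A.subst h) (B.subst h)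
  | all A, h => all (A.subst (liftSubst h))
  | ex A, h => ex (A.subst (liftSubst h))

/-- If `A` is the body of a quantified formula `∀ x A` or `∃ x A`, then `A.inst y` is `A[y/x]`. -/
def inst (A : Formula) (y : ℕ) : Formula :=
  A.subst fun
    | 0 => y
    | n + 1 => n

end Formula

/-- Derivability of sequents `Γ ⊢ B` in MILL1. -/
inductive Derivable : Multiset Formula → Formula → Prop
  | ax (A : Formula) : Derivable {A} A
  | tensorL {Γ : Multiset Formula} {A B C : Formula} :
      Derivable (A ::ₘ B ::ₘ Γ) C → Derivable (A.tensor B ::ₘ Γ) C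
  | tensorR {Γ Δ : Multiset Formula} {A B : Formula} :
      Derivable Γ A → Derivable Δ B → Derivable (Γ + Δ) (A.tensor B)
  | lolliL {Γ Δ : Multiset Formula} {A B C : Formula} :
      Derivable Δ B → Derivable (A ::ₘ Γ) C → Derivable (B.lolli A ::ₘ (Γ + Δ)) C
  | lolliR {Γ : Multiset Formula} {A B : Formula} :
      Derivable (B ::ₘ Γ) A → Derivable Γ (B.lolli A)
  | exL {Γ : Multiset Formula} {A B : Formula} (z : ℕ) :
      (∀ D ∈ Γ, z ∉ D.fvar) → z ∉ A.ex.fvar → z ∉ B.fvar →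
      Derivable (A.inst z ::ₘ Γ) B → Derivable (A.ex ::ₘ Γ) B
  | exR {Γ : Multiset Formula} {A : Formula} (y : ℕ) :
      Derivable Γ (A.inst y) → Derivable Γ A.ex
  | allL {Γ : Multiset Formula} {A B : Formula} (y : ℕ) :
      Derivable (A.inst y ::ₘ Γ) B → Derivable (A.all ::ₘ Γ) B
  | allR {Γ : Multiset Formula} {A : Formula} (z : ℕ) :
      (∀ D ∈ Γ, z ∉ D.fvar) → z ∉ A.all.fvar →
      Derivable Γ (A.inst z) → Derivable Γ A.all

/-- The fixed variable `s`. -/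
def sVar : ℕ := 0

/-- The fixed variable `t`. -/
def tVar : ℕ := 1

/-- `A[x/s, y/t]`. -/
def Formula.substST (A : Formula) (x y : ℕ) : Formula :=
  A.subst fun v => if v = sVar then x else if v = tVar then y else v

/-- A string MILL1 grammar `⟨T, S, ▷⟩` with the finite alphabet `T`; `assign a A` is `a ▷ A`. -/
structure StringGrammar (T : Type*) where
  finite_T : Finite T
  start : Formula
  start_fvar : start.fvar ⊆ {sVar, tVar}
  assign : T → Formula → Prop
  finite_assign : {p : T × Formula | assign p.1 p.2}.Finite
  assign_fvar : ∀ a A, assign a A → A.fvar ⊆ {sVar, tVar}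

/-- The language of a string MILL1 grammar: `a₁…aₙ` is generated if there are formulae `Aᵢ` with
`aᵢ ▷ Aᵢ` such that `A₁[x₀/s, x₁/t], …, Aₙ[xₙ₋₁/s, xₙ/t] ⊢ S[x₀/s, xₙ/t]` is derivable, where
`x₀, …, xₙ` are distinct variables. -/
def StringGrammar.language {T : Type*} (G : StringGrammar T) : Set (List T) :=
  {w | ∃ (A : Fin w.length → Formula) (x : Fin (w.length + 1) → ℕ),
    (∀ i, G.assign (w.get i) (A i)) ∧ Function.Injective x ∧
    Derivable
      ((Finset.univ : Finset (Fin w.length)).val.map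
        fun i => (A i).substST (x i.castSucc) (x i.succ))
      (G.start.substST (x 0) (x (Fin.last w.length)))}

end MILL1

/-! A hypergraph with nodes named by variables is a tensor product of atoms, one for each node and
each hyperedge. It is recorded by its state: the multisets of node names and of hyperedge
descriptions. A rule becomes the closed formula ∀(rhs ⊸ ∃ lhs). In an antecedent it trades a
right-hand side for a left-hand side whose inner nodes are fresh eigenvariables, so proof search
runs a derivation backwards, towards the start hypergraph.

There are no exponentials, so each rule application uses up one formula supplied by a letter. This
is where linear time enters: a letter formula consists of the hyperedge, its target node and a
bounded number of rule formulas, and the rules of a short derivation can be distributed over the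
letters. The start formula supplies the first node and demands the existentially quantified start
hypergraph. A nullary atom replaces the missing unit: each graph formula contains one, so a rule
consumes one and returns one.

Derivations yield proofs by induction on the number of steps (`derivable_of_derivesIn`). For the
converse no normal form of proofs is needed. The formulae are interpreted in a phase model over the
monoid of states, whose pole consists of the states with a repeated node name and the states of
derivable hypergraphs with prescribed names of external nodes. A graph formula denotes the closure
of its state (`sem_graphFormula`), and a rule formula contains 0 because the pole is stable under
rules (`zero_mem_sem_ruleFormula`). Soundness (`Derivable.sound`) then puts the state of the string
graph into the pole; its names are distinct, so the string graph is derivable. -/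

/-! ## Substitution and quantifier blocks -/

namespace MILL1

namespace Formula

/-- The valuation that maps `0` to `y` and `n + 1` to `ρ n`. -/
def consVal (y : ℕ) (ρ : ℕ → ℕ) : ℕ → ℕ
  | 0 => y
  | n + 1 => ρ n

theorem liftSubst_comp (g h : ℕ → ℕ) : liftSubst g ∘ liftSubst h = liftSubst (g ∘ h) := by
  funext n; cases n <;> rfl

theorem consVal_comp_liftSubst (y : ℕ) (ρ h : ℕ → ℕ) :
    consVal y ρ ∘ liftSubst h = consVal y (ρ ∘ h) := by
  funext n; cases n <;> rfl

theorem inst_eq_subst (A : Formula) (y : ℕ) : A.inst y = A.subst (consVal y id) := by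
  unfold inst
  congr 1

theorem subst_subst (A : Formula) : ∀ g h : ℕ → ℕ, (A.subst h).subst g = A.subst (g ∘ h) := by
  induction A with
  | atom p args => intro g h; rfl
  | tensor A B ihA ihB => intro g h; simp [subst, ihA, ihB]
  | lolli A B ihA ihB => intro g h; simp [subst, ihA, ihB]
  | all A ih => intro g h; simp [subst, ih, liftSubst_comp]
  | ex A ih => intro g h; simp [subst, ih, liftSubst_comp]

theorem inst_subst_liftSubst (A : Formula) (h : ℕ → ℕ) (y : ℕ) :
    (A.subst (liftSubst h)).inst y = A.subst (consVal y h) := by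
  rw [inst_eq_subst, subst_subst, consVal_comp_liftSubst]; rfl

theorem subst_eq_self (A : Formula) :
    ∀ h : ℕ → ℕ, (∀ x ∈ A.fvar, h x = x) → A.subst h = A := by
  induction A with
  | atom p args =>
    intro h hh
    simp only [subst]
    congr 1
    funext i
    exact hh _ ⟨i, rfl⟩
  | tensor A B ihA ihB =>
    intro h hh
    simp only [subst, ihA h fun x hx => hh x (Or.inl hx), ihB h fun x hx => hh x (Or.inr hx)]
  | lolli A B ihA ihB =>
    intro h hh
    simp only [subst, ihA h fun x hx => hh x (Or.inl hx), ihB h fun x hx => hh x (Or.inr hx)]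
  | all A ih =>
    intro h hh
    simp only [subst]
    rw [ih]
    rintro (_ | x) hx
    · rfl
    · simpa [liftSubst] using hh x hx
  | ex A ih =>
    intro h hh
    simp only [subst]
    rw [ih]
    rintro (_ | x) hx
    · rfl
    · simpa [liftSubst] using hh x hx

theorem fvar_finite (A : Formula) : A.fvar.Finite := by
  induction A with
  | atom p args => exact Set.finite_range _
  | tensor A B ihA ihB => exact ihA.union ihB
  | lolli A B ihA ihB => exact ihA.union ihB
  | all A ih => exact Set.Finite.preimage (fun _ _ _ _ h => by simpa using h) ih
  | ex A ih => exact Set.Finite.preimage (fun _ _ _ _ h => by simpa using h) ih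

theorem fvar_subst (A : Formula) :
    ∀ h : ℕ → ℕ, ∀ x ∈ (A.subst h).fvar, ∃ y ∈ A.fvar, h y = x := by
  induction A with
  | atom p args => rintro h x ⟨i, rfl⟩; exact ⟨_, ⟨i, rfl⟩, rfl⟩
  | tensor A B ihA ihB =>
    rintro h x (hx | hx)
    · obtain ⟨y, hy, e⟩ := ihA h x hx; exact ⟨y, Or.inl hy, e⟩
    · obtain ⟨y, hy, e⟩ := ihB h x hx; exact ⟨y, Or.inr hy, e⟩
  | lolli A B ihA ihB =>
    rintro h x (hx | hx)
    · obtain ⟨y, hy, e⟩ := ihA h x hx; exact ⟨y, Or.inl hy, e⟩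
    · obtain ⟨y, hy, e⟩ := ihB h x hx; exact ⟨y, Or.inr hy, e⟩
  | all A ih =>
    intro h x hx
    obtain ⟨_ | y, hy, e⟩ := ih _ _ hx
    · simp [liftSubst] at e
    · exact ⟨y, hy, by simpa [liftSubst] using e⟩
  | ex A ih =>
    intro h x hx
    obtain ⟨_ | y, hy, e⟩ := ih _ _ hx
    · simp [liftSubst] at e
    · exact ⟨y, hy, by simpa [liftSubst] using e⟩

theorem fvar_inst (A : Formula) (z x : ℕ) (hx : x ∈ (A.inst z).fvar) :
    x = z ∨ x ∈ A.ex.fvar := by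
  rw [inst_eq_subst] at hx
  obtain ⟨_ | y, hy, rfl⟩ := fvar_subst _ _ _ hx
  · exact Or.inl rfl
  · exact Or.inr hy

/-- A block of `j` existential quantifiers. -/
def exN : ℕ → Formula → Formula
  | 0, A => A
  | j + 1, A => (exN j A).ex

/-- A block of `j` universal quantifiers. -/
def allN : ℕ → Formula → Formula
  | 0, A => A
  | j + 1, A => (allN j A).all

theorem mem_fvar_exN (A : Formula) : ∀ j n, n ∈ (exN j A).fvar ↔ n + j ∈ A.fvar
  | 0, _ => Iff.rfl
  | j + 1, n => by
    change n + 1 ∈ (exN j A).fvar ↔ _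
    rw [mem_fvar_exN A j, show n + 1 + j = n + (j + 1) by omega]

theorem mem_fvar_allN (A : Formula) : ∀ j n, n ∈ (allN j A).fvar ↔ n + j ∈ A.fvar
  | 0, _ => Iff.rfl
  | j + 1, n => by
    change n + 1 ∈ (allN j A).fvar ↔ _
    rw [mem_fvar_allN A j, show n + 1 + j = n + (j + 1) by omega]

end Formula

open Formula

/-- The outermost of `j + 1` quantifiers binds index `j` of the body, so removing it puts `τ j` in
front of the outer valuation. -/
theorem consVal_block {τ σ : ℕ → ℕ} {j : ℕ} (h : ∀ k, τ (k + (j + 1)) = σ k) (k : ℕ) :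
    τ (k + j) = consVal (τ j) σ k := by
  cases k with
  | zero => simp [consVal]
  | succ k => simp only [consVal]; rw [← h k]; congr 1; omega

theorem Derivable.exN_right {Γ : Multiset Formula} {A : Formula} {τ : ℕ → ℕ}
    (hA : Derivable Γ (A.subst τ)) :
    ∀ (j : ℕ) (σ : ℕ → ℕ), (∀ k, τ (k + j) = σ k) → Derivable Γ ((exN j A).subst σ)
  | 0, σ, h => by
    obtain rfl : τ = σ := funext h
    exact hA
  | j + 1, σ, h => by
    refine Derivable.exR (τ j) ?_
    rw [inst_subst_liftSubst]
    exact hA.exN_right j _ (consVal_block h)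

theorem Derivable.allN_left {Γ : Multiset Formula} {A C : Formula} {τ : ℕ → ℕ}
    (hA : Derivable (A.subst τ ::ₘ Γ) C) :
    ∀ (j : ℕ) (σ : ℕ → ℕ), (∀ k, τ (k + j) = σ k) →
      Derivable ((allN j A).subst σ ::ₘ Γ) C
  | 0, σ, h => by
    obtain rfl : τ = σ := funext h
    exact hA
  | j + 1, σ, h => by
    refine Derivable.allL (τ j) ?_
    rw [inst_subst_liftSubst]
    exact hA.allN_left j _ (consVal_block h)

/-- The values `τ i` with `i < j` serve as eigenvariables. Injectivity is needed because the
remaining block may contain the eigenvariable introduced just before. -/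
theorem Derivable.exN_left {Γ : Multiset Formula} {A C : Formula} {τ : ℕ → ℕ}
    (hA : Derivable (A.subst τ ::ₘ Γ) C) :
    ∀ (j : ℕ) (σ : ℕ → ℕ), (∀ k, τ (k + j) = σ k) → Set.InjOn τ (Set.Iio j) →
      (∀ i < j, ∀ D ∈ Γ, τ i ∉ D.fvar) → (∀ i < j, τ i ∉ C.fvar) →
      (∀ i < j, τ i ∉ ((exN j A).subst σ).fvar) →
      Derivable ((exN j A).subst σ ::ₘ Γ) C
  | 0, σ, h, _, _, _, _ => by
    obtain rfl : τ = σ := funext h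
    exact hA
  | j + 1, σ, h, hinj, hΓ, hC, hfv => by
    refine Derivable.exL (τ j) (hΓ j (by omega)) (hfv j (by omega)) (hC j (by omega)) ?_
    rw [inst_subst_liftSubst]
    refine hA.exN_left j _ (consVal_block h)
      (hinj.mono (Set.Iio_subset_Iio (by omega)))
      (fun i hi => hΓ i (by omega)) (fun i hi => hC i (by omega)) fun i hi hmem => ?_
    rw [← inst_subst_liftSubst] at hmem
    rcases fvar_inst _ _ _ hmem with e | e
    · have := hinj (Set.mem_Iio.2 (show i < j + 1 by omega))
        (Set.mem_Iio.2 (show j < j + 1 by omega)) e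
      omega
    · exact hfv i (by omega) e

/-! ## Iterated tensor products -/

/-- The tensor product of a list of formulae, closed by the formula `q`. -/
def tens (q : Formula) : List Formula → Formula
  | [] => q
  | A :: l => A.tensor (tens q l)

theorem subst_tens (q : Formula) (h : ℕ → ℕ) :
    ∀ l : List Formula, (tens q l).subst h = tens (q.subst h) (l.map fun A => A.subst h)
  | [] => rfl
  | A :: l => by simp [tens, subst, subst_tens q h l]

theorem mem_fvar_tens {q : Formula} {x : ℕ} :
    ∀ {l : List Formula}, x ∈ (tens q l).fvar → x ∈ q.fvar ∨ ∃ A ∈ l, x ∈ A.fvar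
  | [], h => Or.inl h
  | A :: l, h => by
    rcases h with h | h
    · exact Or.inr ⟨A, by simp, h⟩
    · rcases mem_fvar_tens h with h | ⟨B, hB, h⟩
      · exact Or.inl h
      · exact Or.inr ⟨B, by simp [hB], h⟩

theorem Derivable.tens_right (q : Formula) :
    ∀ l : List Formula, Derivable (q ::ₘ (l : Multiset Formula)) (tens q l)
  | [] => Derivable.ax q
  | A :: l => by
    have := Derivable.tensorR (Derivable.ax A) (Derivable.tens_right q l)
    rwa [show ({A} : Multiset Formula) + (q ::ₘ (l : Multiset Formula))
      = q ::ₘ ((A :: l : List Formula) : Multiset Formula) by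
        rw [← Multiset.cons_coe, Multiset.singleton_add, Multiset.cons_swap]] at this

theorem Derivable.tens_left {q C : Formula} :
    ∀ (l : List Formula) {Γ : Multiset Formula},
      Derivable (q ::ₘ ((l : Multiset Formula) + Γ)) C → Derivable (tens q l ::ₘ Γ) C
  | [], Γ, h => by simpa [tens] using h
  | A :: l, Γ, h => by
    refine Derivable.tensorL ?_
    rw [Multiset.cons_swap]
    refine Derivable.tens_left l ?_
    rwa [← Multiset.cons_coe, Multiset.cons_add, ← Multiset.add_cons] at h

theorem Derivable.map_left {ι : Type*} {F : ι → Multiset Formula} {A : ι → Formula} {C : Formula}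
    (hF : ∀ i Γ, Derivable (F i + Γ) C → Derivable (A i ::ₘ Γ) C) (s : Multiset ι) :
    ∀ Γ, Derivable ((s.map F).sum + Γ) C → Derivable (s.map A + Γ) C := by
  induction s using Multiset.induction with
  | empty => simp
  | cons i s ih =>
    intro Γ h
    rw [Multiset.map_cons, Multiset.cons_add]
    refine hF i _ ?_
    rw [add_left_comm]
    refine ih _ ?_
    rwa [Multiset.map_cons, Multiset.sum_cons, add_assoc, add_left_comm] at h

/-- Axioms and left rules have a nonempty antecedent, and right rules have a compound succedent. -/
theorem not_derivable_zero_atom (p : PredSymbol) (args : Fin p.arity → ℕ) :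
    ¬ Derivable 0 (.atom p args) := by
  intro h
  generalize hΓ : (0 : Multiset Formula) = Γ at h
  generalize hB : Formula.atom p args = B at h
  cases h <;> simp_all [eq_comm]

/-! ## Phase semantics -/

section Semantics

variable {M : Type*} [AddCommMonoid M] (P : Set M)
  (I : (p : PredSymbol) → (Fin p.arity → ℕ) → M)

/-- The closure of `{x}` with respect to the pole `P`. -/
def cl (x : M) : Set M := {m | ∀ u, x + u ∈ P → m + u ∈ P}

/-- The phase semantics of formulae, for the pole `P`, the interpretation `I` of atoms, and a
valuation of variables. -/
def sem : Formula → (ℕ → ℕ) → Set M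
  | .atom p args, ρ => cl P (I p (ρ ∘ args))
  | .tensor A B, ρ =>
    {m | ∀ u, (∀ a ∈ sem A ρ, ∀ b ∈ sem B ρ, a + b + u ∈ P) → m + u ∈ P}
  | .lolli A B, ρ => {m | ∀ a ∈ sem A ρ, m + a ∈ sem B ρ}
  | .all A, ρ => {m | ∀ y, m ∈ sem A (consVal y ρ)}
  | .ex A, ρ => {m | ∀ u, (∀ y, ∀ a ∈ sem A (consVal y ρ), a + u ∈ P) → m + u ∈ P}

theorem sem_subst (A : Formula) :
    ∀ h ρ : ℕ → ℕ, sem P I (A.subst h) ρ = sem P I A (ρ ∘ h) := by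
  induction A with
  | atom p args => intro h ρ; rfl
  | tensor A B ihA ihB => intro h ρ; simp only [subst, sem, ihA, ihB]
  | lolli A B ihA ihB => intro h ρ; simp only [subst, sem, ihA, ihB]
  | all A ih => intro h ρ; simp only [subst, sem, ih, consVal_comp_liftSubst]
  | ex A ih => intro h ρ; simp only [subst, sem, ih, consVal_comp_liftSubst]

theorem sem_congr (A : Formula) :
    ∀ ρ ρ' : ℕ → ℕ, (∀ x ∈ A.fvar, ρ x = ρ' x) → sem P I A ρ = sem P I A ρ' := by
  induction A with
  | atom p args =>
    intro ρ ρ' h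
    have : ρ ∘ args = ρ' ∘ args := funext fun i => h _ ⟨i, rfl⟩
    simp only [sem, this]
  | tensor A B ihA ihB =>
    intro ρ ρ' h
    simp only [sem, ihA ρ ρ' fun x hx => h x (Or.inl hx), ihB ρ ρ' fun x hx => h x (Or.inr hx)]
  | lolli A B ihA ihB =>
    intro ρ ρ' h
    simp only [sem, ihA ρ ρ' fun x hx => h x (Or.inl hx), ihB ρ ρ' fun x hx => h x (Or.inr hx)]
  | all A ih =>
    intro ρ ρ' h
    have : ∀ y, sem P I A (consVal y ρ) = sem P I A (consVal y ρ') := fun y =>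
      ih _ _ (by rintro (_ | x) hx; exacts [rfl, h x hx])
    simp only [sem, this]
  | ex A ih =>
    intro ρ ρ' h
    have : ∀ y, sem P I A (consVal y ρ) = sem P I A (consVal y ρ') := fun y =>
      ih _ _ (by rintro (_ | x) hx; exacts [rfl, h x hx])
    simp only [sem, this]

/-- Every formula denotes a closed set (a fact). Membership can therefore be tested against contexts
`u`, which is how the left rules are validated. -/
theorem sem_closed (A : Formula) :
    ∀ (ρ : ℕ → ℕ) (m : M), (∀ u, (∀ a ∈ sem P I A ρ, a + u ∈ P) → m + u ∈ P) →
      m ∈ sem P I A ρ := by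
  induction A with
  | atom p args => exact fun ρ m h u hu => h u fun a ha => ha u hu
  | tensor A B ihA ihB => exact fun ρ m h u hu => h u fun a ha => ha u hu
  | lolli A B ihA ihB =>
    intro ρ m h a ha
    refine ihB _ _ fun u hu => ?_
    rw [add_assoc]
    refine h _ fun b hb => ?_
    rw [← add_assoc]
    exact hu _ (hb a ha)
  | all A ih => exact fun ρ m h y => ih _ _ fun u hu => h u fun a ha => hu _ (ha y)
  | ex A ih => exact fun ρ m h u hu => h u fun a ha => ha u hu

variable {P I}

theorem add_mem_sem_tensor {A B : Formula} {ρ : ℕ → ℕ} {a b : M}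
    (ha : a ∈ sem P I A ρ) (hb : b ∈ sem P I B ρ) : a + b ∈ sem P I (A.tensor B) ρ :=
  fun _ h => h a ha b hb

theorem mem_sem_ex {A : Formula} {ρ : ℕ → ℕ} {a : M} (y : ℕ)
    (ha : a ∈ sem P I A (consVal y ρ)) : a ∈ sem P I A.ex ρ :=
  fun _ h => h y a ha

theorem sem_inst_update (A : Formula) (ρ : ℕ → ℕ) (y z : ℕ) (hz : z ∉ A.ex.fvar) :
    sem P I (A.inst z) (Function.update ρ z y) = sem P I A (consVal y ρ) := by
  rw [inst_eq_subst, sem_subst]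
  refine sem_congr P I _ _ _ ?_
  rintro (_ | x) hx
  · simp [consVal]
  · have : x ≠ z := fun e => hz (e ▸ hx)
    simp [consVal, this]

open scoped Pointwise in
-- For the rules with an eigenvariable `z`, the induction hypothesis is used at the valuation
-- updated at `z`; freshness makes the update invisible to the rest of the sequent.
theorem Derivable.sound {Γ : Multiset Formula} {B : Formula} (h : Derivable Γ B) :
    ∀ (ρ : ℕ → ℕ), ∀ m ∈ (Γ.map fun A => sem P I A ρ).sum, m ∈ sem P I B ρ := by
  have upd : ∀ (Γ : Multiset Formula) (ρ : ℕ → ℕ) (y z : ℕ), (∀ D ∈ Γ, z ∉ D.fvar) →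
      (Γ.map fun A => sem P I A (Function.update ρ z y)) = Γ.map fun A => sem P I A ρ := by
    intro Γ ρ y z hz
    refine Multiset.map_congr rfl fun D hD => sem_congr P I _ _ _ fun x hx => ?_
    have : x ≠ z := fun e => hz D hD (e ▸ hx)
    simp [this]
  induction h with
  | ax A => intro ρ m hm; simpa using hm
  | @tensorL Γ A B C _ ih =>
    intro ρ m hm
    simp only [Multiset.map_cons, Multiset.sum_cons] at hm ih
    obtain ⟨a, ha, g, hg, rfl⟩ := Set.mem_add.1 hm
    refine sem_closed P I _ _ _ fun u hu => ?_
    rw [add_assoc]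
    refine ha _ fun x hx y hy => ?_
    rw [← add_assoc]
    refine hu _ (ih ρ _ ?_)
    rw [add_assoc]
    exact Set.add_mem_add hx (Set.add_mem_add hy hg)
  | tensorR _ _ ih1 ih2 =>
    intro ρ m hm
    rw [Multiset.map_add, Multiset.sum_add] at hm
    obtain ⟨a, ha, b, hb, rfl⟩ := Set.mem_add.1 hm
    exact add_mem_sem_tensor (ih1 ρ a ha) (ih2 ρ b hb)
  | lolliL _ _ ih1 ih2 =>
    intro ρ m hm
    simp only [Multiset.map_cons, Multiset.sum_cons, Multiset.map_add, Multiset.sum_add] at hm ih2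
    obtain ⟨a, ha, g, hg, rfl⟩ := Set.mem_add.1 hm
    obtain ⟨b, hb, c, hc, rfl⟩ := Set.mem_add.1 hg
    refine ih2 ρ _ ?_
    rw [add_comm b c, ← add_assoc]
    exact Set.add_mem_add (ha _ (ih1 ρ c hc)) hb
  | lolliR _ ih =>
    intro ρ m hm a ha
    refine ih ρ _ ?_
    rw [Multiset.map_cons, Multiset.sum_cons, add_comm m]
    exact Set.add_mem_add ha hm
  | @exL Γ A B z hΓ hA hB _ ih =>
    intro ρ m hm
    simp only [Multiset.map_cons, Multiset.sum_cons] at hm ih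
    obtain ⟨a, ha, g, hg, rfl⟩ := Set.mem_add.1 hm
    refine sem_closed P I _ _ _ fun u hu => ?_
    rw [add_assoc]
    refine ha _ fun y x hx => ?_
    rw [← add_assoc]
    refine hu _ ?_
    have := ih (Function.update ρ z y) (x + g)
    rw [upd Γ ρ y z hΓ, sem_inst_update A ρ y z hA] at this
    rw [sem_congr P I B ρ (Function.update ρ z y)]
    · exact this (Set.add_mem_add hx hg)
    · intro x hx
      have : x ≠ z := fun e => hB (e ▸ hx)
      simp [this]
  | @exR Γ A y _ ih =>
    intro ρ m hm
    have := ih ρ m hm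
    rw [inst_eq_subst, sem_subst] at this
    refine mem_sem_ex (ρ y) ?_
    rwa [show consVal (ρ y) ρ = ρ ∘ consVal y id by funext n; cases n <;> rfl]
  | @allL Γ A B y _ ih =>
    intro ρ m hm
    simp only [Multiset.map_cons, Multiset.sum_cons] at hm ih
    obtain ⟨a, ha, g, hg, rfl⟩ := Set.mem_add.1 hm
    refine ih ρ _ (Set.add_mem_add ?_ hg)
    rw [inst_eq_subst, sem_subst,
      show ρ ∘ consVal y id = consVal (ρ y) ρ by funext n; cases n <;> rfl]
    exact ha (ρ y)
  | @allR Γ A z hΓ hA _ ih =>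
    intro ρ m hm y
    have := ih (Function.update ρ z y) m
    rw [upd Γ ρ y z hΓ, sem_inst_update A ρ y z hA] at this
    exact this hm

theorem mem_sem_exN {A : Formula} {τ : ℕ → ℕ} {m : M} (hm : m ∈ sem P I A τ) :
    ∀ (j : ℕ) (ρ : ℕ → ℕ), (∀ k, τ (k + j) = ρ k) → m ∈ sem P I (exN j A) ρ
  | 0, ρ, h => by
    obtain rfl : τ = ρ := funext h
    exact hm
  | j + 1, ρ, h => mem_sem_ex (τ j) (mem_sem_exN hm j _ (consVal_block h))

theorem sem_exN_add_mem {A : Formula} {u : M} :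
    ∀ (j : ℕ) (ρ : ℕ → ℕ),
      (∀ τ : ℕ → ℕ, (∀ k, τ (k + j) = ρ k) → ∀ a ∈ sem P I A τ, a + u ∈ P) →
      ∀ m ∈ sem P I (exN j A) ρ, m + u ∈ P
  | 0, ρ, h, m, hm => h ρ (fun _ => rfl) m hm
  | j + 1, ρ, h, m, hm => by
    refine hm u fun y => sem_exN_add_mem j _ fun τ hτ => h τ fun k => ?_
    rw [show k + (j + 1) = k + 1 + j by omega, hτ]; rfl

theorem mem_sem_allN {A : Formula} {m : M} :
    ∀ (j : ℕ) (ρ : ℕ → ℕ), (∀ τ : ℕ → ℕ, (∀ k, τ (k + j) = ρ k) → m ∈ sem P I A τ) →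
      m ∈ sem P I (allN j A) ρ
  | 0, ρ, h => h ρ fun _ => rfl
  | j + 1, ρ, h => fun y => mem_sem_allN j _ fun τ hτ => h τ fun k => by
    rw [show k + (j + 1) = k + 1 + j by omega, hτ]; rfl

/-- Closures of single elements are stable under the tensor product, so a whole graph formula is
represented by one state. -/
theorem sem_tensor_of_cl {A B : Formula} {ρ : ℕ → ℕ} {x y : M} (hA : sem P I A ρ = cl P x)
    (hB : sem P I B ρ = cl P y) : sem P I (A.tensor B) ρ = cl P (x + y) := by
  ext m
  simp only [sem, hA, hB]
  constructor
  · intro hm u hu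
    refine hm u fun a ha b hb => ?_
    rw [add_assoc]
    refine ha _ ?_
    rw [add_left_comm]
    refine hb _ ?_
    rwa [add_left_comm, ← add_assoc]
  · exact fun hm u hu => hm u (hu x (fun _ h => h) y fun _ h => h)

theorem sem_tens_map {ι : Type*} {q : Formula} {ρ : ℕ → ℕ} (hq : sem P I q ρ = cl P 0)
    {F : ι → Formula} {x : ι → M} :
    ∀ l : List ι, (∀ i ∈ l, sem P I (F i) ρ = cl P (x i)) →
      sem P I (tens q (l.map F)) ρ = cl P (l.map x).sum
  | [], _ => hq
  | i :: l, h =>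
    sem_tensor_of_cl (h i (by simp)) (sem_tens_map hq l fun k hk => h k (by simp [hk]))

end Semantics

end MILL1

/-! ## Multisets of values of finite families -/

section Families

variable {α α' β γ : Type*}

/-- The multiset of values of a finite family. -/
noncomputable def famMS [Finite α] (f : α → β) : Multiset β :=
  (@Finset.univ α (Fintype.ofFinite α)).val.map f

theorem famMS_eq [Fintype α] (f : α → β) : famMS f = Finset.univ.val.map f := by
  unfold famMS
  congr!

theorem mem_famMS [Finite α] {f : α → β} {b : β} : b ∈ famMS f ↔ ∃ a, f a = b := by
  simp [famMS]

theorem map_famMS [Finite α] (f : α → β) (g : β → γ) :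
    (famMS f).map g = famMS fun a => g (f a) := by
  simp [famMS, Multiset.map_map]

theorem nodup_famMS [Finite α] {f : α → β} : (famMS f).Nodup ↔ Function.Injective f := by
  constructor
  · intro h a b hab
    exact Multiset.inj_on_of_nodup_map h a (by simp) b (by simp) hab
  · exact fun h => Multiset.Nodup.map h (Finset.nodup _)

theorem famMS_equiv [Finite α] [Finite α'] (e : α ≃ α') (f : α' → β) :
    famMS (fun a => f (e a)) = famMS f := by
  have := Fintype.ofFinite α
  have := Fintype.ofFinite α'
  rw [famMS_eq, famMS_eq, ← Finset.map_univ_equiv e, Finset.map_val, Multiset.map_map]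
  rfl

theorem famMS_sum [Finite α] [Finite α'] (f : α ⊕ α' → β) :
    famMS f = famMS (fun a => f (Sum.inl a)) + famMS fun a => f (Sum.inr a) := by
  have := Fintype.ofFinite α
  have := Fintype.ofFinite α'
  rw [famMS_eq, famMS_eq, famMS_eq, ← Finset.univ_disjSum_univ, Finset.val_disjSum,
    Multiset.disjSum, Multiset.map_add, Multiset.map_map, Multiset.map_map]
  rfl

theorem famMS_subtype_add [Finite α] (p : α → Prop) (f : α → β) :
    famMS f = famMS (fun a : {a // ¬ p a} => f a) + famMS fun a : {a // p a} => f a := by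
  classical
  rw [← famMS_equiv (Equiv.sumCompl p) f, famMS_sum, add_comm]
  rfl

theorem famMS_unique [Finite α] [Unique α] (f : α → β) : famMS f = {f default} := by
  simp [famMS_eq]

/-- Equal multiplicities mean equipotent fibres, and bijections between the fibres assemble into
one. -/
theorem exists_equiv_of_famMS_eq [Finite α] [Finite α'] {f : α → β} {g : α' → β}
    (h : famMS f = famMS g) : ∃ e : α ≃ α', ∀ a, g (e a) = f a := by
  classical
  have := Fintype.ofFinite α
  have := Fintype.ofFinite α'
  rw [famMS_eq, famMS_eq] at h
  have key : ∀ c, Nonempty ({a // f a = c} ≃ {b // g b = c}) := by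
    intro c
    refine Fintype.card_eq.1 ?_
    have h2 := congrArg (Multiset.count c) h
    rw [Multiset.count_map, Multiset.count_map] at h2
    rw [Fintype.card_subtype, Fintype.card_subtype, Finset.card_def, Finset.card_def,
      Finset.filter_val, Finset.filter_val]
    simpa [eq_comm] using h2
  have e := fun c => (key c).some
  exact ⟨Equiv.ofFiberEquiv e, fun a => Equiv.ofFiberEquiv_map e a⟩

theorem famMS_get (l : List β) : famMS l.get = l := by
  rw [famMS_eq]
  simp

theorem sum_famMS [Fintype α] [AddCommMonoid β] (f : α → β) : (famMS f).sum = ∑ a, f a := by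
  rw [famMS_eq]; rfl

theorem sum_famMS_singleton [Finite α] (f : α → β) :
    (famMS fun a => ({f a} : Multiset β)).sum = famMS f := by
  have := Fintype.ofFinite α
  rw [← map_famMS f fun b => ({b} : Multiset β), Multiset.sum_map_singleton]

theorem sum_famMS_prod [Finite α] [AddCommMonoid β] [AddCommMonoid γ] (f : α → β) (g : α → γ) :
    (famMS fun a => (f a, g a)).sum = ((famMS f).sum, (famMS g).sum) := by
  have := Fintype.ofFinite α
  simp only [sum_famMS]
  exact Prod.ext (by simp [Prod.fst_sum]) (by simp [Prod.snd_sum])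

theorem sum_famMS_zero [Finite α] [AddCommMonoid β] : (famMS fun _ : α => (0 : β)).sum = 0 := by
  have := Fintype.ofFinite α
  simp [sum_famMS]

theorem famMS_fin_succ {n : ℕ} (f : Fin (n + 1) → β) :
    famMS f = f 0 ::ₘ famMS fun i : Fin n => f i.succ := by
  rw [famMS_eq, famMS_eq, Fin.univ_succ, Finset.cons_val, Multiset.map_cons, Finset.map_val,
    Multiset.map_map]
  rfl

end Families

/-! ## States of hypergraphs with named nodes -/

namespace HGraph

variable {Sel : Type*} {C : Type*} {ty : C → Set Sel}

instance (H : HGraph ty) : Finite H.V := H.finite_V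

instance (H : HGraph ty) : Finite H.E := H.finite_E

theorem Iso.refl (H : HGraph ty) : H.Iso H :=
  ⟨Equiv.refl _, Equiv.refl _, fun _ => rfl, fun _ _ _ _ => rfl, rfl, fun _ _ _ => rfl⟩

theorem Iso.symm {H K : HGraph ty} (h : H.Iso K) : K.Iso H := by
  obtain ⟨fV, fE, hl, ha, ht, hx⟩ := h
  refine ⟨fV.symm, fE.symm, fun e => ?_, fun e σ h h' => ?_, ht.symm, fun σ h h' => ?_⟩
  · rw [← hl, fE.apply_symm_apply]
  · obtain ⟨e, rfl⟩ := fE.surjective e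
    rw [Equiv.eq_symm_apply]
    have : ∀ e' (_ : e' = e) (h'' : σ ∈ ty (H.lab e')),
        fV (H.att e' ⟨σ, h''⟩) = K.att (fE e) ⟨σ, h⟩ := by
      rintro _ rfl h''
      exact (ha _ σ h'' h).symm
    exact this _ (fE.symm_apply_apply e) h'
  · rw [Equiv.eq_symm_apply]
    exact (hx σ h' h).symm

theorem Iso.trans {H K L : HGraph ty} (h₁ : H.Iso K) (h₂ : K.Iso L) : H.Iso L := by
  obtain ⟨fV, fE, hl, ha, ht, hx⟩ := h₁
  obtain ⟨gV, gE, hl', ha', ht', hx'⟩ := h₂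
  refine ⟨fV.trans gV, fE.trans gE, fun e => (hl' _).trans (hl e), fun e σ h h' => ?_,
    ht.trans ht', fun σ h h' => ?_⟩
  · have hm : σ ∈ ty (K.lab (fE e)) := by rwa [hl]
    exact (ha' _ σ hm h').trans (congrArg gV (ha e σ h hm))
  · have hm : σ ∈ K.type := ht ▸ h
    exact (hx' σ hm h').trans (congrArg gV (hx σ h hm))

theorem Iso.lift {H K : HGraph ty} (X : Set Sel) (h : H.Iso K) : (H.lift X).Iso (K.lift X) := by
  obtain ⟨fV, fE, hl, ha, ht, hx⟩ := h
  exact ⟨fV, fE, fun e => congrArg some (hl e), ha, ht, hx⟩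

open Classical in
/-- The description of a hyperedge by its label and the names of its attachment nodes. -/
noncomputable def edgeTok (H : HGraph ty) (f : H.V → ℕ) (e : H.E) : C × (Sel → ℕ) :=
  (H.lab e, fun σ => if h : σ ∈ ty (H.lab e) then f (H.att e ⟨σ, h⟩) else 0)

theorem edgeTok_snd (H : HGraph ty) (f : H.V → ℕ) (e : H.E) {σ : Sel} (h : σ ∈ ty (H.lab e)) :
    (H.edgeTok f e).2 σ = f (H.att e ⟨σ, h⟩) := dif_pos h

/-- The state of a hypergraph whose nodes are named by natural numbers: the multiset of node names
and the multiset of descriptions of hyperedges. -/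
noncomputable def state (H : HGraph ty) (f : H.V → ℕ) : Multiset ℕ × Multiset (C × (Sel → ℕ)) :=
  (famMS f, famMS (H.edgeTok f))

theorem edgeTok_iso {H K : HGraph ty} {fV : H.V ≃ K.V} {fE : H.E ≃ K.E}
    (hl : ∀ e, K.lab (fE e) = H.lab e)
    (ha : ∀ (e : H.E) (σ : Sel) (h : σ ∈ ty (H.lab e)) (h' : σ ∈ ty (K.lab (fE e))),
      K.att (fE e) ⟨σ, h'⟩ = fV (H.att e ⟨σ, h⟩)) (g : K.V → ℕ) (e : H.E) :
    K.edgeTok g (fE e) = H.edgeTok (fun v => g (fV v)) e := by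
  refine Prod.ext (hl e) (funext fun σ => ?_)
  by_cases h : σ ∈ ty (H.lab e)
  · have h' : σ ∈ ty (K.lab (fE e)) := by rwa [hl]
    rw [edgeTok_snd _ _ _ h, edgeTok_snd _ _ _ h', ha e σ h h']
  · have h' : σ ∉ ty (K.lab (fE e)) := by rwa [hl]
    simp only [edgeTok, dif_neg h, dif_neg h']

theorem Iso.exists_naming {H K : HGraph ty} (h : H.Iso K) (g : K.V → ℕ) :
    ∃ f : H.V → ℕ, H.state f = K.state g ∧ H.type = K.type ∧
      ∀ σ h h', f (H.ext ⟨σ, h⟩) = g (K.ext ⟨σ, h'⟩) := by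
  obtain ⟨fV, fE, hl, ha, ht, hx⟩ := h
  refine ⟨fun v => g (fV v), ?_, ht, fun σ h h' => by rw [hx σ h h']⟩
  refine Prod.ext (famMS_equiv fV g) ?_
  simp only [state]
  rw [← famMS_equiv fE]
  exact congrArg famMS (funext fun e => (edgeTok_iso hl ha g e).symm)

/-- Equal states give bijections that preserve node names and hyperedge descriptions. Since `g` is
injective, names determine nodes, so attachments agree as well. -/
theorem iso_of_state_eq {H K : HGraph ty} {f : H.V → ℕ} {g : K.V → ℕ}
    (hg : Function.Injective g) (hs : H.state f = K.state g) (ht : H.type = K.type)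
    (hx : ∀ σ h h', f (H.ext ⟨σ, h⟩) = g (K.ext ⟨σ, h'⟩)) : H.Iso K := by
  obtain ⟨fV, hV⟩ := exists_equiv_of_famMS_eq (congrArg Prod.fst hs)
  obtain ⟨fE, hE⟩ := exists_equiv_of_famMS_eq (congrArg Prod.snd hs)
  refine ⟨fV, fE, fun e => congrArg Prod.fst (hE e), fun e σ h h' => hg ?_, ht,
    fun σ h h' => hg ?_⟩
  · rw [hV, ← edgeTok_snd K g _ h', hE, edgeTok_snd]
  · rw [hV, hx σ h h']

theorem state_snd_mem {H : HGraph ty} {f : H.V → ℕ} {t : C × (Sel → ℕ)} (h : t ∈ (H.state f).2) :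
    (∀ σ ∈ ty t.1, t.2 σ ∈ (H.state f).1) ∧ ∀ σ ∉ ty t.1, t.2 σ = 0 := by
  obtain ⟨e, rfl⟩ := mem_famMS.1 h
  refine ⟨fun σ hσ => ?_, fun σ hσ => dif_neg hσ⟩
  rw [edgeTok_snd _ _ _ hσ]
  exact mem_famMS.2 ⟨_, rfl⟩

/-- The names themselves serve as nodes and the listed descriptions as hyperedges. -/
theorem exists_state_eq (m : Multiset ℕ × Multiset (C × (Sel → ℕ))) (hnd : m.1.Nodup)
    (hm : ∀ t ∈ m.2, (∀ σ ∈ ty t.1, t.2 σ ∈ m.1) ∧ ∀ σ ∉ ty t.1, t.2 σ = 0)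
    (X : Set Sel) (ε : Sel → ℕ) (hε : ∀ σ ∈ X, ε σ ∈ m.1) :
    ∃ (H : HGraph ty) (f : H.V → ℕ), Function.Injective f ∧ H.state f = m ∧ H.type = X ∧
      ∀ σ h, f (H.ext ⟨σ, h⟩) = ε σ := by
  have hmem : ∀ i, m.2.toList.get i ∈ m.2 := fun i =>
    Multiset.mem_toList.1 (List.get_mem _ _)
  let H : HGraph ty :=
    { V := {x // x ∈ m.1}
      E := Fin m.2.toList.length
      finite_V := Finite.of_injective (fun x : {x // x ∈ m.1} =>
        (⟨x.1, Multiset.mem_toFinset.2 x.2⟩ : m.1.toFinset))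
        fun x y h => Subtype.ext (by simpa using h)
      finite_E := inferInstance
      lab := fun i => (m.2.toList.get i).1
      att := fun i σ => ⟨(m.2.toList.get i).2 σ, (hm _ (hmem i)).1 σ σ.2⟩
      type := X
      ext := fun σ => ⟨ε σ, hε σ σ.2⟩ }
  refine ⟨H, Subtype.val, Subtype.val_injective, Prod.ext ?_ ?_, rfl, fun _ _ => rfl⟩
  · refine (Multiset.Nodup.ext (nodup_famMS.2 Subtype.val_injective) hnd).2 fun x => ?_
    rw [mem_famMS]
    exact ⟨by rintro ⟨a, rfl⟩; exact a.2, fun hx => ⟨⟨x, hx⟩, rfl⟩⟩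
  · have : H.edgeTok Subtype.val = m.2.toList.get := by
      funext i
      refine Prod.ext rfl (funext fun σ => ?_)
      by_cases hσ : σ ∈ ty (m.2.toList.get i).1
      · exact dif_pos hσ
      · exact (dif_neg hσ).trans ((hm _ (hmem i)).2 σ hσ).symm
    change famMS (H.edgeTok Subtype.val) = m.2
    rw [this]
    exact (famMS_get _).trans (Multiset.coe_toList _)

theorem state_lift (H : HGraph ty) (X : Set Sel) (f : H.V → ℕ) :
    (H.lift X).state f = ((H.state f).1, (H.state f).2.map (Prod.map some id)) := by
  refine Prod.ext rfl ?_
  simp only [state, map_famMS]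
  rfl

/-! ### Hyperedge replacement on states -/

section Replace

variable {K : HGraph ty} {e : K.E}

/-- The state of `K` without the hyperedge `e` and the nodes it is attached to. -/
noncomputable def restState (K : HGraph ty) (e : K.E) (f : K.V → ℕ) :
    Multiset ℕ × Multiset (C × (Sel → ℕ)) :=
  (famMS fun v : {v // ¬ ∃ σ, K.att e σ = v} => f v,
    famMS fun d : {d // d ≠ e} => K.edgeTok f d)

theorem state_eq_restState_add [Finite (ty (K.lab e))] (hinj : Function.Injective (K.att e))
    (f : K.V → ℕ) :
    K.state f = K.restState e f + (famMS (fun σ => f (K.att e σ)), {K.edgeTok f e}) := by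
  refine Prod.ext ?_ ?_
  · refine (famMS_subtype_add (fun v => ∃ σ, K.att e σ = v) f).trans (congrArg _ ?_)
    exact (famMS_equiv (Equiv.ofInjective _ hinj) fun a => f a.1).symm
  · refine (famMS_subtype_add (fun d => d = e) (K.edgeTok f)).trans (congrArg _ ?_)
    exact famMS_unique _

open Classical in
/-- The nodes of `K[e/R]` are those of `R` and the nodes of `K` to which `e` is not attached. -/
noncomputable def replaceEquiv (hinj : Function.Injective (K.att e)) (R : HGraph ty)
    (h : ty (K.lab e) = R.type) :
    (K.replace e R h).V ≃ {v // ¬ ∃ σ, K.att e σ = v} ⊕ R.V where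
  toFun := Quot.lift
    (Sum.elim
      (fun v => if hv : ∃ σ, K.att e σ = v
        then Sum.inr (R.ext ⟨hv.choose.1, h ▸ hv.choose.2⟩) else Sum.inl ⟨v, hv⟩) Sum.inr) (by
      rintro _ _ ⟨σ, rfl, rfl⟩
      have hv : ∃ σ', K.att e σ' = K.att e σ := ⟨σ, rfl⟩
      have hc : hv.choose = σ := hinj hv.choose_spec
      simp only [Sum.elim_inl, Sum.elim_inr, dif_pos hv, hc])
  invFun := Sum.elim (fun v => Quot.mk _ (Sum.inl v.1)) fun w => Quot.mk _ (Sum.inr w)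
  left_inv := by
    rintro ⟨v | w⟩
    · by_cases hv : ∃ σ, K.att e σ = v
      · simp only [Sum.elim_inl, dif_pos hv]
        exact (Quot.sound ⟨hv.choose, by rw [hv.choose_spec], rfl⟩).symm
      · simp only [Sum.elim_inl, dif_neg hv]
        rfl
    · rfl
  right_inv := by
    rintro (⟨v, hv⟩ | w)
    · exact dif_neg hv
    · rfl

/-- As the attachment of `e` is injective, gluing never merges two nodes of `R`, and replacement is
addition of states. -/
theorem state_replace (hinj : Function.Injective (K.att e)) (R : HGraph ty)
    (h : ty (K.lab e) = R.type) (g : (K.replace e R h).V → ℕ) :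
    (K.replace e R h).state g = R.state (fun v => g (Quot.mk _ (Sum.inr v))) +
      K.restState e fun v => g (Quot.mk _ (Sum.inl v)) := by
  refine Prod.ext ?_ ?_
  · change famMS g = _
    rw [← famMS_equiv (replaceEquiv hinj R h).symm, famMS_sum, add_comm]
    rfl
  · exact (famMS_sum (α := {d : K.E // d ≠ e}) (α' := R.E)
      ((K.replace e R h).edgeTok g)).trans (add_comm _ _)

/-- A naming of the nodes of `K[e/R]`. -/
def glueNaming (R : HGraph ty) (h : ty (K.lab e) = R.type) (fK : K.V → ℕ) (fR : R.V → ℕ)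
    (hc : ∀ σ (hσ : σ ∈ ty (K.lab e)) (hσ' : σ ∈ R.type),
      fK (K.att e ⟨σ, hσ⟩) = fR (R.ext ⟨σ, hσ'⟩)) : (K.replace e R h).V → ℕ :=
  Quot.lift (Sum.elim fK fR) (by
    rintro _ _ ⟨σ, rfl, rfl⟩
    exact hc σ.1 σ.2 _)

theorem state_replace_lift {X : Set Sel} {K : HGraph (extTy ty X)} {e : K.E}
    (hinj : Function.Injective (K.att e)) (R : HGraph ty)
    (h : extTy ty X (K.lab e) = R.type) (g : (K.replace e (R.lift X) h).V → ℕ) :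
    (K.replace e (R.lift X) h).state g =
      ((R.state fun v => g (Quot.mk _ (Sum.inr v))).1,
        (R.state fun v => g (Quot.mk _ (Sum.inr v))).2.map (Prod.map some id)) +
      K.restState e fun v => g (Quot.mk _ (Sum.inl v)) :=
  (state_replace hinj (R.lift X) h g).trans (congrArg (· + _) (state_lift R X _))

end Replace

/-- Forget the descriptions of hyperedges with the fresh label. -/
def unliftToks (m : Multiset (Option C × (Sel → ℕ))) : Multiset (C × (Sel → ℕ)) :=
  m.filterMap fun p => p.1.map fun c => (c, p.2)

theorem unliftToks_map_some (m : Multiset (C × (Sel → ℕ))) :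
    unliftToks (m.map (Prod.map some id)) = m := by
  rw [unliftToks, Multiset.filterMap_map]
  exact Multiset.filterMap_some m

theorem unliftToks_add (m m' : Multiset (Option C × (Sel → ℕ))) :
    unliftToks (m + m') = unliftToks m + unliftToks m' := by
  induction m, m' using Quotient.inductionOn₂ with
  | h l l' => exact congrArg _ List.filterMap_append

end HGraph

/-! ### Rule steps as rewriting of states -/

namespace HTRule

open HGraph

variable {Sel : Type*} {C : Type*} {ty : C → Set Sel} {r : HTRule ty}

theorem Step.congr_right {G G' G'' : HGraph ty} (h : r.Step G G') (hi : G'.Iso G'') :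
    r.Step G G'' := by
  obtain ⟨K, e, h, hinj, h₁, h₂⟩ := h
  exact ⟨K, e, h, hinj, h₁, (hi.lift _).symm.trans h₂⟩

/-- Undoes a step on states: the context `u` is fixed by a naming of the result, while the names of
the inner nodes of the left-hand side remain free to be chosen. -/
theorem Step.exists_state {G G' : HGraph ty} (hs : r.Step G G') (f : G'.V → ℕ) :
    ∃ (fr : r.rhs.V → ℕ) (u : Multiset ℕ × Multiset (C × (Sel → ℕ))),
      G'.state f = r.rhs.state fr + u ∧ G.type = G'.type ∧
      ∀ fl : r.lhs.V → ℕ, (∀ σ h h', fl (r.lhs.ext ⟨σ, h⟩) = fr (r.rhs.ext ⟨σ, h'⟩)) →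
        (r.lhs.state fl + u).1.Nodup →
        ∃ f' : G.V → ℕ, Function.Injective f' ∧ G.state f' = r.lhs.state fl + u ∧
          ∀ σ h h', f' (G.ext ⟨σ, h⟩) = f (G'.ext ⟨σ, h'⟩) := by
  obtain ⟨K, e, h, hinj, h₁, h₂⟩ := hs
  obtain ⟨g, hg, ht, hgx⟩ := h₂.symm.exists_naming f
  let fK : K.V → ℕ := fun v => g (Quot.mk _ (Sum.inl v))
  let fr : r.rhs.V → ℕ := fun v => g (Quot.mk _ (Sum.inr v))
  have hcomp : ∀ m m' : Multiset ℕ × Multiset (C × (Sel → ℕ)),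
      (m'.1, m'.2.map (Prod.map some id)) + K.restState e fK =
        (m.1, m.2.map (Prod.map some id)) →
      m = m' + ((K.restState e fK).1, unliftToks (K.restState e fK).2) := by
    intro m m' hm
    refine Prod.ext (congrArg Prod.fst hm).symm ?_
    have := congrArg (fun p => unliftToks p.2) hm
    simp only [Prod.snd_add, unliftToks_add, unliftToks_map_some] at this
    exact this.symm
  refine ⟨fr, ((K.restState e fK).1, unliftToks (K.restState e fK).2), ?_, ?_, ?_⟩
  · exact hcomp _ _ ((state_replace_lift hinj r.rhs _ g).symm.trans
      (hg.trans (state_lift G' _ f)))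
  · obtain ⟨_, _, _, _, ht₁, _⟩ := h₁
    exact ht₁.trans ht
  · intro fl hfl hnd
    have hc : ∀ σ (hσ : σ ∈ extTy ty r.lhs.type (K.lab e)) (hσ' : σ ∈ r.lhs.type),
        fK (K.att e ⟨σ, hσ⟩) = fl (r.lhs.ext ⟨σ, hσ'⟩) := by
      intro σ hσ hσ'
      have hσ'' : σ ∈ r.rhs.type := r.type_eq ▸ hσ'
      rw [hfl σ hσ' hσ'']
      exact congrArg g (Quot.sound ⟨⟨σ, hσ⟩, rfl, rfl⟩)
    obtain ⟨f', hf', ht', hfx'⟩ := h₁.exists_naming (glueNaming (r.lhs.lift _) h fK fl hc)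
    have hst : G.state f' = r.lhs.state fl +
        ((K.restState e fK).1, unliftToks (K.restState e fK).2) :=
      hcomp _ _ ((state_replace_lift hinj r.lhs h _).symm.trans
        (hf'.symm.trans (state_lift G _ f')))
    refine ⟨f', ?_, hst, fun σ h h' => ?_⟩
    · rw [← hst] at hnd
      exact nodup_famMS.1 hnd
    · have hK : σ ∈ K.type := ht' ▸ h
      exact (hfx' σ h hK).trans (hgx σ hK h')

/-- Performs a step on states. The assumptions `hu` and `hx` are the dangling condition: an inner
node of the matched left-hand side is neither used by the context nor external. -/
theorem exists_step {G : HGraph ty} {f : G.V → ℕ} (hf : Function.Injective f)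
    {u : Multiset ℕ × Multiset (C × (Sel → ℕ))} {fl : r.lhs.V → ℕ}
    (hfl : G.state f = r.lhs.state fl + u) {fr : r.rhs.V → ℕ}
    (hlr : ∀ σ h h', fl (r.lhs.ext ⟨σ, h⟩) = fr (r.rhs.ext ⟨σ, h'⟩))
    (hnd : (r.rhs.state fr + u).1.Nodup)
    (hu : ∀ v, (∀ σ, r.lhs.ext σ ≠ v) → ∀ t ∈ u.2, ∀ σ ∈ ty t.1, t.2 σ ≠ fl v)
    (hx : ∀ v, (∀ σ, r.lhs.ext σ ≠ v) → ∀ σ, f (G.ext σ) ≠ fl v) :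
    ∃ (G' : HGraph ty) (f' : G'.V → ℕ), r.Step G G' ∧ Function.Injective f' ∧
      G'.state f' = r.rhs.state fr + u ∧ G.type = G'.type ∧
      ∀ σ h h', f (G.ext ⟨σ, h⟩) = f' (G'.ext ⟨σ, h'⟩) := by
  classical
  have hndG : (r.lhs.state fl + u).1.Nodup := hfl ▸ nodup_famMS.2 hf
  have hflinj : Function.Injective fl := nodup_famMS.1 (Multiset.nodup_add.1 hndG).1
  have hfin : Finite r.lhs.type := Finite.of_injective _ r.lhs_inj
  let ε : Sel → ℕ := fun σ => if h : σ ∈ G.type then f (G.ext ⟨σ, h⟩) else 0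
  have hε : ∀ σ h, ε σ = f (G.ext ⟨σ, h⟩) := fun σ h => dif_pos h
  -- names of nodes that remain in the context
  have key : ∀ x, x ∈ (G.state f).1 → (∀ v, (∀ σ, r.lhs.ext σ ≠ v) → x ≠ fl v) →
      x ∈ u.1 ∨ ∃ σ, fl (r.lhs.ext σ) = x := by
    intro x hxm hxv
    rw [hfl] at hxm
    rcases Multiset.mem_add.1 hxm with h | h
    · obtain ⟨v, rfl⟩ := mem_famMS.1 h
      by_contra! hcon
      exact hxv v (fun σ e => hcon.2 σ (by rw [e])) rfl
    · exact Or.inl h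
  have keyu : ∀ t ∈ u.2, (∀ σ ∈ ty t.1, t.2 σ ∈ u.1 ∨ ∃ σ', fl (r.lhs.ext σ') = t.2 σ) ∧
      ∀ σ ∉ ty t.1, t.2 σ = 0 := by
    intro t ht
    have := state_snd_mem (H := G) (f := f) (t := t)
      (by rw [hfl]; exact Multiset.mem_add.2 (Or.inr ht))
    exact ⟨fun σ hσ => key _ (this.1 σ hσ) fun v hv => hu v hv t ht σ hσ, this.2⟩
  have keyx : ∀ σ ∈ G.type, ε σ ∈ u.1 ∨ ∃ σ', fl (r.lhs.ext σ') = ε σ := by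
    intro σ hσ
    rw [hε σ hσ]
    exact key _ (mem_famMS.2 ⟨_, rfl⟩) fun v hv => hx v hv _
  have hrmem : ∀ σ, fl (r.lhs.ext σ) ∈ (r.rhs.state fr).1 := fun σ => by
    rw [hlr σ.1 σ.2 (r.type_eq ▸ σ.2)]
    exact mem_famMS.2 ⟨_, rfl⟩
  have hmem_rhs : ∀ x, (x ∈ u.1 ∨ ∃ σ', fl (r.lhs.ext σ') = x) → x ∈ (r.rhs.state fr + u).1 := by
    rintro x (h | ⟨σ, rfl⟩)
    · exact Multiset.mem_add.2 (Or.inr h)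
    · exact Multiset.mem_add.2 (Or.inl (hrmem σ))
  obtain ⟨G', f', hf', hs', ht', hx'⟩ := exists_state_eq (ty := ty) (r.rhs.state fr + u) hnd
    (by
      intro t ht
      rcases Multiset.mem_add.1 ht with h | h
      · exact ⟨fun σ hσ => Multiset.mem_add.2 (Or.inl ((state_snd_mem h).1 σ hσ)),
          (state_snd_mem h).2⟩
      · exact ⟨fun σ hσ => hmem_rhs _ ((keyu t h).1 σ hσ), (keyu t h).2⟩)
    G.type ε (fun σ hσ => hmem_rhs _ (keyx σ hσ))
  -- The context hypergraph `K` consists of `u`, the nodes named by the external nodes of the rule,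
  -- and one hyperedge with the fresh label attached to these nodes.
  let t₀ : Option C × (Sel → ℕ) :=
    (none, fun σ => if h : σ ∈ r.lhs.type then fl (r.lhs.ext ⟨σ, h⟩) else 0)
  have ht₀ : ∀ σ (h : σ ∈ r.lhs.type), t₀.2 σ = fl (r.lhs.ext ⟨σ, h⟩) := fun σ h => dif_pos h
  let n₀ : Multiset ℕ := famMS fun σ => fl (r.lhs.ext σ)
  have hmem_K : ∀ x, (x ∈ u.1 ∨ ∃ σ', fl (r.lhs.ext σ') = x) → x ∈ u.1 + n₀ := by
    rintro x (h | ⟨σ, rfl⟩)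
    · exact Multiset.mem_add.2 (Or.inl h)
    · exact Multiset.mem_add.2 (Or.inr (mem_famMS.2 ⟨σ, rfl⟩))
  obtain ⟨K, fK, hfK, hsK, htK, hxK⟩ := exists_state_eq (ty := extTy ty r.lhs.type)
    (u.1 + n₀, t₀ ::ₘ u.2.map (Prod.map some id))
    (by
      refine Multiset.nodup_add.2 ⟨(Multiset.nodup_add.1 hndG).2.1,
        nodup_famMS.2 (hflinj.comp r.lhs_inj), ?_⟩
      refine Multiset.disjoint_left.2 fun {x} hxu hxn => ?_
      obtain ⟨σ, rfl⟩ := mem_famMS.1 hxn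
      exact Multiset.disjoint_left.1 (Multiset.nodup_add.1 hndG).2.2
        (mem_famMS.2 ⟨_, rfl⟩) hxu)
    (by
      intro t ht
      rcases Multiset.mem_cons.1 ht with rfl | h
      · exact ⟨fun σ hσ => hmem_K _ (Or.inr ⟨⟨σ, hσ⟩, (ht₀ σ hσ).symm⟩), fun σ hσ => dif_neg hσ⟩
      · obtain ⟨t, htu, rfl⟩ := Multiset.mem_map.1 h
        exact ⟨fun σ hσ => hmem_K _ ((keyu t htu).1 σ hσ), (keyu t htu).2⟩)
    G.type ε (fun σ hσ => hmem_K _ (keyx σ hσ))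
  obtain ⟨e, he⟩ : ∃ e, K.edgeTok fK e = t₀ := by
    have : t₀ ∈ (K.state fK).2 := by rw [hsK]; exact Multiset.mem_cons_self _ _
    exact mem_famMS.1 this
  have hlab : K.lab e = none := congrArg Prod.fst he
  have h : extTy ty r.lhs.type (K.lab e) = r.lhs.type := by rw [hlab]; rfl
  have hatt : ∀ σ (hσ : σ ∈ extTy ty r.lhs.type (K.lab e)) (hσ' : σ ∈ r.lhs.type),
      fK (K.att e ⟨σ, hσ⟩) = fl (r.lhs.ext ⟨σ, hσ'⟩) := by
    intro σ hσ hσ'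
    rw [← edgeTok_snd K fK e hσ, he, ht₀]
  have hinj : Function.Injective (K.att e) := by
    rintro ⟨σ, hσ⟩ ⟨σ', hσ'⟩ heq
    have := congrArg fK heq
    rw [hatt σ hσ (h ▸ hσ), hatt σ' hσ' (h ▸ hσ')] at this
    exact Subtype.ext (Subtype.mk.inj (r.lhs_inj (hflinj this)))
  -- Removing `e` and its attachment nodes leaves `u`, by cancellation in the monoid of states.
  have hrest : K.restState e fK = (u.1, u.2.map (Prod.map some id)) := by
    have : Finite (extTy ty r.lhs.type (K.lab e)) := by rw [h]; exact hfin
    have h1 := state_eq_restState_add hinj fK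
    have h2 : famMS (fun σ => fK (K.att e σ)) = n₀ := by
      refine Eq.trans ?_ (famMS_equiv (Equiv.setCongr h) fun σ => fl (r.lhs.ext σ))
      exact congrArg famMS (funext fun σ => hatt σ.1 σ.2 (h.subset σ.2))
    rw [hsK, h2, he] at h1
    refine Prod.ext ?_ ?_
    · exact (add_right_cancel (congrArg Prod.fst h1)).symm
    · have h3 := congrArg Prod.snd h1
      simp only [Prod.snd_add, ← Multiset.singleton_add] at h3
      rw [add_comm] at h3
      exact (add_right_cancel h3).symm
  refine ⟨G', f', ⟨K, e, h, hinj, ?_, ?_⟩, hf', hs', ht'.symm, fun σ h h' => ?_⟩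
  · refine Iso.symm (iso_of_state_eq (f := glueNaming _ h fK fl hatt) (g := f) hf ?_ htK ?_)
    · refine (state_replace_lift hinj r.lhs h _).trans (Eq.trans ?_ (state_lift G _ f).symm)
      rw [hfl]
      refine (congrArg (_ + ·) hrest).trans ?_
      exact Prod.ext rfl (Multiset.map_add _ _ _).symm
    · intro σ h h'
      exact (hxK σ h).trans (hε σ h')
  · have hatt' : ∀ σ (hσ : σ ∈ extTy ty r.lhs.type (K.lab e)) (hσ' : σ ∈ r.rhs.type),
        fK (K.att e ⟨σ, hσ⟩) = fr (r.rhs.ext ⟨σ, hσ'⟩) := fun σ hσ hσ' => by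
      rw [hatt σ hσ (h ▸ hσ), hlr]
    refine Iso.symm (iso_of_state_eq
      (f := glueNaming (r.rhs.lift _) (h.trans r.type_eq) fK fr hatt') (g := f') hf' ?_
      (htK.trans ht'.symm) ?_)
    · refine (state_replace_lift hinj r.rhs (h.trans r.type_eq) _).trans
        (Eq.trans ?_ (state_lift G' _ f').symm)
      rw [hs']
      refine (congrArg (_ + ·) hrest).trans ?_
      exact Prod.ext rfl (Multiset.map_add _ _ _).symm
    · intro σ h h'
      exact (hxK σ h).trans (hx' σ h').symm
  · rw [hx' σ h', hε σ h]

end HTRule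

namespace HTSystem

variable {Sel : Type*} {C : Type*} {ty : C → Set Sel} {G : HTSystem ty}

theorem DerivesIn.congr_right {n : ℕ} {H K L : HGraph ty} (h : G.DerivesIn n H K)
    (hi : K.Iso L) : G.DerivesIn n H L := by
  cases h with
  | refl h => exact .refl (h.trans hi)
  | step h hr hs => exact .step h hr (hs.congr_right hi)

theorem DerivesIn.type_eq {n : ℕ} {H K : HGraph ty} (h : G.DerivesIn n H K) :
    H.type = K.type := by
  induction h with
  | refl h => obtain ⟨_, _, _, _, ht, _⟩ := h; exact ht
  | step _ _ hs ih =>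
    obtain ⟨_, _, _, _, ⟨_, _, _, _, h₁, _⟩, ⟨_, _, _, _, h₂, _⟩⟩ := hs
    exact ih.trans (h₁.trans h₂.symm)

end HTSystem

/-! ## Fresh names -/

namespace HGraph

variable {Sel : Type*} {C : Type*} {ty : C → Set Sel}

open Classical in
/-- The naming of nodes that maps `ext σ` to `b σ`, and maps the other nodes injectively to numbers
that are greater than or equal to `N`. -/
noncomputable def extNaming (H : HGraph ty) (b : Sel → ℕ) (N : ℕ) (v : H.V) : ℕ :=
  if h : ∃ σ, H.ext σ = v then b h.choose.1 else N + Finite.equivFin H.V v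

variable {H : HGraph ty}

theorem extNaming_ext (hinj : Function.Injective H.ext) (b : Sel → ℕ) (N : ℕ) (σ : H.type) :
    H.extNaming b N (H.ext σ) = b σ := by
  have h : ∃ σ', H.ext σ' = H.ext σ := ⟨σ, rfl⟩
  rw [extNaming, dif_pos h, hinj h.choose_spec]

theorem extNaming_of_forall_ne (b : Sel → ℕ) (N : ℕ) {v : H.V} (hv : ∀ σ, H.ext σ ≠ v) :
    H.extNaming b N v = N + Finite.equivFin H.V v :=
  dif_neg fun ⟨σ, h⟩ => hv σ h

end HGraph

namespace HTRule

open HGraph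

variable {Sel : Type*} {C : Type*} {ty : C → Set Sel} {r : HTRule ty}

theorem nodup_extNaming {fr : r.rhs.V → ℕ} {u : Multiset ℕ × Multiset (C × (Sel → ℕ))}
    (hnd : (r.rhs.state fr + u).1.Nodup) {b : Sel → ℕ}
    (hb : ∀ σ h, b σ = fr (r.rhs.ext ⟨σ, h⟩)) {N : ℕ}
    (hN : ∀ x ∈ (r.rhs.state fr + u).1, x < N) :
    (r.lhs.state (r.lhs.extNaming b N) + u).1.Nodup := by
  have hb' : ∀ σ : r.lhs.type, r.lhs.extNaming b N (r.lhs.ext σ) =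
      fr (r.rhs.ext ⟨σ, r.type_eq ▸ σ.2⟩) := fun σ => by
    rw [extNaming_ext r.lhs_inj, hb]
  obtain ⟨hr, hu, hd⟩ := Multiset.nodup_add.1 hnd
  have hrm : ∀ v, fr v ∈ (r.rhs.state fr).1 := fun v => mem_famMS.2 ⟨v, rfl⟩
  have hlt : ∀ v, fr v < N := fun v => hN _ (Multiset.mem_add.2 (Or.inl (hrm v)))
  refine Multiset.nodup_add.2 ⟨nodup_famMS.2 fun v w hvw => ?_, hu, ?_⟩
  · by_cases hv : ∃ σ, r.lhs.ext σ = v <;> by_cases hw : ∃ σ, r.lhs.ext σ = w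
    · obtain ⟨σ, rfl⟩ := hv
      obtain ⟨σ', rfl⟩ := hw
      rw [hb', hb'] at hvw
      have := r.rhs_inj (nodup_famMS.1 hr hvw)
      rw [Subtype.ext (Subtype.mk.inj this)]
    · obtain ⟨σ, rfl⟩ := hv
      rw [hb', extNaming_of_forall_ne _ _ (not_exists.1 hw)] at hvw
      have := hlt (r.rhs.ext ⟨σ, r.type_eq ▸ σ.2⟩)
      omega
    · obtain ⟨σ, rfl⟩ := hw
      rw [hb', extNaming_of_forall_ne _ _ (not_exists.1 hv)] at hvw
      have := hlt (r.rhs.ext ⟨σ, r.type_eq ▸ σ.2⟩)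
      omega
    · rw [extNaming_of_forall_ne _ _ (not_exists.1 hv),
        extNaming_of_forall_ne _ _ (not_exists.1 hw)] at hvw
      exact (Finite.equivFin _).injective (Fin.ext (by omega))
  · refine Multiset.disjoint_left.2 fun {x} hx hxu => ?_
    obtain ⟨v, rfl⟩ := mem_famMS.1 hx
    by_cases hv : ∃ σ, r.lhs.ext σ = v
    · obtain ⟨σ, rfl⟩ := hv
      rw [hb'] at hxu
      exact Multiset.disjoint_left.1 hd (hrm _) hxu
    · have := hN _ (Multiset.mem_add.2 (Or.inr hxu))
      rw [extNaming_of_forall_ne _ _ (not_exists.1 hv)] at this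
      omega

end HTRule

/-! ## Hypergraphs and rules as formulae -/

namespace MILL1

open HGraph Formula

section Encoding

variable {Sel : Type*} {C : Type*} {ty : C → Set Sel}

/-- An atom without arguments, which takes the place of the multiplicative unit. -/
def unitAtom : Formula := .atom ⟨0, 0⟩ Fin.elim0

/-- The atom that stands for a node. -/
def nodeAtom (x : ℕ) : Formula := .atom ⟨1, 1⟩ fun _ => x

/-- The list of nodes and hyperedges. -/
noncomputable def elems (H : HGraph ty) : List (H.V ⊕ H.E) :=
  (@Finset.univ (H.V ⊕ H.E) (Fintype.ofFinite _)).toList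

theorem coe_map_elems {β : Type*} (H : HGraph ty) (F : H.V ⊕ H.E → β) :
    (((elems H).map F : List β) : Multiset β) =
      famMS (fun v => F (Sum.inl v)) + famMS fun e => F (Sum.inr e) := by
  rw [← famMS_sum, ← Multiset.map_coe, elems, Finset.coe_toList]
  rfl

/-- Indices below the number of nodes belong to the quantifier block and receive the values of `f`;
larger ones are shifted back and evaluated by `ρ`. -/
theorem exists_valuation {H : HGraph ty} (hinj : Function.Injective H.ext) {b : Sel → ℕ}
    {ρ : ℕ → ℕ} {f : H.V → ℕ} (hf : ∀ σ, f (H.ext σ) = ρ (b σ)) :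
    ∃ τ : ℕ → ℕ, (∀ k, τ (k + Nat.card H.V) = ρ k) ∧
      ∀ v, τ (H.extNaming (fun σ => b σ + Nat.card H.V) 0 v) = f v := by
  refine ⟨fun i => if h : i < Nat.card H.V then f ((Finite.equivFin H.V).symm ⟨i, h⟩)
    else ρ (i - Nat.card H.V), fun k => by simp, fun v => ?_⟩
  by_cases h : ∃ σ, H.ext σ = v
  · obtain ⟨σ, rfl⟩ := h
    simp [extNaming_ext hinj, hf]
  · rw [extNaming_of_forall_ne _ _ (not_exists.1 h)]
    simp

open Classical in
/-- The names of external nodes in the formula of a rule. -/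
noncomputable def ruleBase (r : HTRule ty) (σ : Sel) : ℕ :=
  if h : σ ∈ r.rhs.type then Finite.equivFin r.rhs.V (r.rhs.ext ⟨σ, h⟩) else 0

theorem exists_rule_valuation (r : HTRule ty) (fr : r.rhs.V → ℕ) :
    ∃ τ : ℕ → ℕ, (∀ k, τ (k + Nat.card r.rhs.V) = k) ∧
      ∀ v, τ (Finite.equivFin r.rhs.V v) = fr v :=
  ⟨fun i => if h : i < Nat.card r.rhs.V then fr ((Finite.equivFin r.rhs.V).symm ⟨i, h⟩)
    else i - Nat.card r.rhs.V, fun k => by simp, fun v => by simp⟩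

theorem ruleBase_eq (r : HTRule ty) (σ : Sel) (h : σ ∈ r.rhs.type) :
    ruleBase r σ = Finite.equivFin r.rhs.V (r.rhs.ext ⟨σ, h⟩) := dif_pos h

theorem exists_forall_lt_of_finite {F : Set ℕ} (hF : F.Finite) : ∃ N, ∀ x ∈ F, x < N := by
  obtain ⟨N, hN⟩ := hF.bddAbove
  exact ⟨N + 1, fun x hx => Nat.lt_succ_of_le (hN hx)⟩

variable [∀ c, Finite (ty c)] (name : C → ℕ)

variable (ty) in
/-- The atom that stands for a hyperedge. -/
noncomputable def edgeAtom (t : C × (Sel → ℕ)) : Formula :=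
  .atom ⟨name t.1 + 2, Nat.card (ty t.1)⟩ fun i => t.2 ((Finite.equivFin (ty t.1)).symm i)

/-- The atom that stands for a node or a hyperedge of a hypergraph with named nodes. -/
noncomputable def graphAtom (H : HGraph ty) (f : H.V → ℕ) : H.V ⊕ H.E → Formula :=
  Sum.elim (fun v => nodeAtom (f v)) fun e => edgeAtom ty name (H.edgeTok f e)

/-- The formula that describes a hypergraph with named nodes. -/
noncomputable def graphFormula (H : HGraph ty) (f : H.V → ℕ) : Formula :=
  tens unitAtom ((elems H).map (graphAtom name H f))

variable (ty) in
/-- The multiset of atoms that corresponds to a state. -/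
noncomputable def stateAtoms (m : Multiset ℕ × Multiset (C × (Sel → ℕ))) : Multiset Formula :=
  m.1.map nodeAtom + m.2.map (edgeAtom ty name)

theorem stateAtoms_add (m m' : Multiset ℕ × Multiset (C × (Sel → ℕ))) :
    stateAtoms ty name (m + m') = stateAtoms ty name m + stateAtoms ty name m' := by
  simp only [stateAtoms, Prod.fst_add, Prod.snd_add, Multiset.map_add]
  exact add_add_add_comm _ _ _ _

theorem coe_map_graphAtom (H : HGraph ty) (f : H.V → ℕ) :
    (((elems H).map (graphAtom name H f) : List Formula) : Multiset Formula) =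
      stateAtoms ty name (H.state f) := by
  rw [coe_map_elems, stateAtoms, state, map_famMS, map_famMS]
  rfl

theorem edgeAtom_edgeTok (H : HGraph ty) (f : H.V → ℕ) (e : H.E) :
    edgeAtom ty name (H.edgeTok f e) = .atom ⟨name (H.lab e) + 2, Nat.card (ty (H.lab e))⟩
      fun i => f (H.att e ((Finite.equivFin (ty (H.lab e))).symm i)) := by
  unfold edgeAtom
  refine congrArg (Formula.atom _) (funext fun i => ?_)
  exact edgeTok_snd H f e _

theorem subst_graphFormula (H : HGraph ty) (f : H.V → ℕ) (h : ℕ → ℕ) :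
    (graphFormula name H f).subst h = graphFormula name H fun v => h (f v) := by
  rw [graphFormula, subst_tens, List.map_map]
  refine congrArg₂ tens (congrArg (Formula.atom _) (funext fun i => i.elim0))
    (List.map_congr_left fun i _ => ?_)
  rcases i with v | e
  · rfl
  · simp only [graphAtom, Function.comp_apply, Sum.elim_inr, edgeAtom_edgeTok]
    rfl

theorem mem_fvar_graphFormula {H : HGraph ty} {f : H.V → ℕ} {x : ℕ}
    (hx : x ∈ (graphFormula name H f).fvar) : ∃ v, f v = x := by
  rcases mem_fvar_tens hx with ⟨i, -⟩ | ⟨A, hA, hx⟩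
  · exact i.elim0
  · obtain ⟨v | e, -, rfl⟩ := List.mem_map.1 hA
    · obtain ⟨i, rfl⟩ := hx
      exact ⟨v, rfl⟩
    · simp only [graphAtom, Sum.elim_inr, edgeAtom_edgeTok] at hx
      obtain ⟨i, rfl⟩ := hx
      exact ⟨_, rfl⟩

/-- The description of a hypergraph, with the external nodes named by `b` and all other nodes bound
by existential quantifiers. (There are also vacuous quantifiers, one for each external node.) -/
noncomputable def exGraph (H : HGraph ty) (b : Sel → ℕ) : Formula :=
  exN (Nat.card H.V) (graphFormula name H (H.extNaming (fun σ => b σ + Nat.card H.V) 0))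

theorem mem_fvar_exGraph {H : HGraph ty} {b : Sel → ℕ} {x : ℕ}
    (hx : x ∈ (exGraph name H b).fvar) : ∃ σ ∈ H.type, b σ = x := by
  rw [exGraph, mem_fvar_exN] at hx
  obtain ⟨v, hv⟩ := mem_fvar_graphFormula name hx
  by_cases h : ∃ σ, H.ext σ = v
  · rw [extNaming, dif_pos h] at hv
    exact ⟨_, h.choose.2, by omega⟩
  · rw [extNaming_of_forall_ne _ _ (not_exists.1 h)] at hv
    have := (Finite.equivFin H.V v).isLt
    omega

theorem Derivable.exGraph_right {Γ : Multiset Formula} {H : HGraph ty}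
    (hinj : Function.Injective H.ext) {b : Sel → ℕ} {ρ : ℕ → ℕ} {f : H.V → ℕ}
    (hf : ∀ σ, f (H.ext σ) = ρ (b σ)) (h : Derivable Γ (graphFormula name H f)) :
    Derivable Γ ((exGraph name H b).subst ρ) := by
  obtain ⟨τ, hτ, hv⟩ := exists_valuation hinj hf
  refine Derivable.exN_right (τ := τ) ?_ _ _ hτ
  rw [subst_graphFormula]
  simpa only [hv] using h

theorem Derivable.exGraph_left {Γ : Multiset Formula} {B : Formula} {H : HGraph ty}
    (hinj : Function.Injective H.ext) {b : Sel → ℕ} {ρ : ℕ → ℕ} {N : ℕ}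
    (hΓ : ∀ D ∈ Γ, ∀ x ∈ D.fvar, x < N) (hB : ∀ x ∈ B.fvar, x < N)
    (hH : ∀ x ∈ ((exGraph name H b).subst ρ).fvar, x < N)
    (h : Derivable (graphFormula name H (H.extNaming (fun σ => ρ (b σ)) N) ::ₘ Γ) B) :
    Derivable ((exGraph name H b).subst ρ ::ₘ Γ) B := by
  let τ : ℕ → ℕ := fun i => if i < Nat.card H.V then N + i else ρ (i - Nat.card H.V)
  have hτ : ∀ i < Nat.card H.V, τ i = N + i := fun i hi => if_pos hi
  refine Derivable.exN_left (τ := τ) ?_ _ _ (fun k => by simp [τ]) ?_ ?_ ?_ ?_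
  · rw [subst_graphFormula]
    convert h using 4 with v
    by_cases hv : ∃ σ, H.ext σ = v
    · obtain ⟨σ, rfl⟩ := hv
      simp [extNaming_ext hinj, τ]
    · rw [extNaming_of_forall_ne _ _ (not_exists.1 hv),
        extNaming_of_forall_ne _ _ (not_exists.1 hv), hτ _ (by simp)]
      omega
  · intro i hi k hk hik
    rw [hτ i hi, hτ k hk] at hik
    omega
  · intro i hi D hD hx
    have := hΓ D hD _ hx
    rw [hτ i hi] at this
    omega
  · intro i hi hx
    have := hB _ hx
    rw [hτ i hi] at this
    omega
  · intro i hi hx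
    have := hH _ hx
    rw [hτ i hi] at this
    omega

/-- The formula that describes the reversal of a rule. -/
noncomputable def ruleFormula (r : HTRule ty) : Formula :=
  allN (Nat.card r.rhs.V)
    ((graphFormula name r.rhs fun v => Finite.equivFin r.rhs.V v).lolli
      (exGraph name r.lhs (ruleBase r)))

theorem fvar_ruleFormula (r : HTRule ty) (x : ℕ) : x ∉ (ruleFormula name r).fvar := by
  intro hx
  rw [ruleFormula, mem_fvar_allN] at hx
  rcases hx with hx | hx
  · obtain ⟨v, hv⟩ := mem_fvar_graphFormula name hx
    have := (Finite.equivFin r.rhs.V v).isLt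
    omega
  · obtain ⟨σ, hσ, h⟩ := mem_fvar_exGraph name hx
    rw [ruleBase, dif_pos (r.type_eq ▸ hσ)] at h
    have := (Finite.equivFin r.rhs.V (r.rhs.ext ⟨σ, r.type_eq ▸ hσ⟩)).isLt
    omega

/-- One rule applied backwards in an antecedent. The set `F` lists further names that the fresh ones
must avoid. -/
theorem Derivable.ruleFormula_left {Γ : Multiset Formula} {B : Formula} {r : HTRule ty}
    {fr : r.rhs.V → ℕ} {F : Set ℕ} (hF : F.Finite)
    (h : ∀ (b : Sel → ℕ) (N : ℕ), (∀ σ h, b σ = fr (r.rhs.ext ⟨σ, h⟩)) → (∀ x ∈ F, x < N) →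
      Derivable (unitAtom ::ₘ (stateAtoms ty name (r.lhs.state (r.lhs.extNaming b N)) + Γ)) B) :
    Derivable (ruleFormula name r ::ₘ
      (Γ + unitAtom ::ₘ stateAtoms ty name (r.rhs.state fr))) B := by
  obtain ⟨τ, hτ, hv⟩ := exists_rule_valuation r fr
  -- The identity substitution is inserted to match the form of `Derivable.allN_left`.
  rw [← subst_eq_self (ruleFormula name r) id fun x _ => rfl]
  refine Derivable.allN_left (τ := τ) ?_ _ _ hτ
  refine Derivable.lolliL ?_ ?_
  · rw [subst_graphFormula]
    simp only [hv]
    rw [← coe_map_graphAtom]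
    exact Derivable.tens_right _ _
  · have hfin : (F ∪ (⋃ D ∈ {D | D ∈ Γ}, D.fvar) ∪ B.fvar ∪
        ((exGraph name r.lhs (ruleBase r)).subst τ).fvar).Finite :=
      ((hF.union ((Multiset.finite_toSet Γ).biUnion fun D _ => fvar_finite D)).union
        (fvar_finite B)).union (fvar_finite _)
    obtain ⟨N, hN⟩ := exists_forall_lt_of_finite hfin
    refine Derivable.exGraph_left name r.lhs_inj (N := N)
      (fun D hD x hx => hN x (Or.inl (Or.inl (Or.inr (Set.mem_biUnion hD hx)))))
      (fun x hx => hN x (Or.inl (Or.inr hx))) (fun x hx => hN x (Or.inr hx)) ?_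
    refine Derivable.tens_left _ ?_
    rw [coe_map_graphAtom]
    refine h _ N (fun σ hσ => ?_) fun x hx => hN x (Or.inl (Or.inl (Or.inl hx)))
    rw [ruleBase_eq r σ hσ, hv]

/-- The list of rules is chosen before the naming `f`, since undoing the last step calls the
induction hypothesis at a naming with new fresh names. -/
theorem derivable_of_derivesIn {G : HTSystem ty} {b : Sel → ℕ} {ρ : ℕ → ℕ} {n : ℕ}
    {S H : HGraph ty} (hS : Function.Injective S.ext) (hd : G.DerivesIn n S H) :
    ∃ l : List G.P, l.length = n ∧ ∀ f : H.V → ℕ, Function.Injective f →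
      (∀ σ h, f (H.ext ⟨σ, h⟩) = ρ (b σ)) →
      Derivable (unitAtom ::ₘ (stateAtoms ty name (H.state f) +
        ((l.map fun r => ruleFormula name r.1 : List Formula) : Multiset Formula)))
        ((exGraph name S b).subst ρ) := by
  induction hd with
  | refl hi =>
    refine ⟨[], rfl, fun f _ hx => ?_⟩
    obtain ⟨g, hg, ht, hgx⟩ := hi.exists_naming f
    refine Derivable.exGraph_right name hS (f := g) (fun σ => ?_) ?_
    · rw [hgx σ.1 σ.2 (ht ▸ σ.2), hx]
    · rw [← hg, ← coe_map_graphAtom]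
      simpa [graphFormula] using
        Derivable.tens_right unitAtom ((elems _).map (graphAtom name _ g))
  | @step n S H' H'' r _ hr hs ih =>
    obtain ⟨l, hl, ih⟩ := ih hS
    refine ⟨⟨r, hr⟩ :: l, by simp [hl], fun f hf hx => ?_⟩
    obtain ⟨fr, u, hfr, ht, hstep⟩ := hs.exists_state f
    have hnd : (r.rhs.state fr + u).1.Nodup := hfr ▸ nodup_famMS.2 hf
    have := Derivable.ruleFormula_left name (r := r) (fr := fr)
      (Γ := stateAtoms ty name u +
        ((l.map fun r => ruleFormula name r.1 : List Formula) : Multiset Formula))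
      (B := (exGraph name S b).subst ρ)
      (Multiset.finite_toSet (r.rhs.state fr + u).1) fun β N hβ hN => by
        obtain ⟨f', hf', hst, hx'⟩ := hstep (r.lhs.extNaming β N)
          (fun σ h h' => by rw [extNaming_ext r.lhs_inj]; exact hβ σ h')
          (HTRule.nodup_extNaming hnd hβ hN)
        have := ih f' hf' fun σ h => by rw [hx' σ h (ht ▸ h), hx]
        rwa [hst, stateAtoms_add, add_assoc] at this
    rw [hfr, stateAtoms_add, List.map_cons, ← Multiset.cons_coe]
    convert this using 1
    simp only [Multiset.add_cons, Multiset.cons_swap unitAtom]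
    congr 2
    abel

/-! ## Interpretation of the formulae -/

open Classical in
variable (ty) in
/-- The hyperedge with label `c` described by an atom. -/
noncomputable def atomTok (c : C) (p : PredSymbol) (args : Fin p.arity → ℕ) : C × (Sel → ℕ) :=
  (c, fun σ => if h : σ ∈ ty c then
    (if h' : (Finite.equivFin (ty c) ⟨σ, h⟩ : ℕ) < p.arity then args ⟨_, h'⟩ else 0) else 0)

open Classical in
variable (ty) in
/-- The state described by an atom. -/
noncomputable def atomState (A : Set C) (p : PredSymbol) (args : Fin p.arity → ℕ) :
    Multiset ℕ × Multiset (C × (Sel → ℕ)) :=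
  if p.name = 0 then 0
  else if p.name = 1 then (if h : 0 < p.arity then ({args ⟨0, h⟩}, 0) else 0)
  else if h : ∃ c ∈ A, name c + 2 = p.name then (0, {atomTok ty h.choose p args})
  else 0

variable {name}

section Interpretation

variable {A : Set C} {P : Set (Multiset ℕ × Multiset (C × (Sel → ℕ)))}

theorem sem_unitAtom (ρ : ℕ → ℕ) : sem P (atomState ty name A) unitAtom ρ = cl P 0 := by
  simp [unitAtom, sem, atomState]

theorem sem_nodeAtom (ρ : ℕ → ℕ) (x : ℕ) :
    sem P (atomState ty name A) (nodeAtom x) ρ = cl P ({ρ x}, 0) := by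
  simp [nodeAtom, sem, atomState]

open Classical in
theorem sem_edgeAtom (hname : Set.InjOn name A) (ρ : ℕ → ℕ) {t : C × (Sel → ℕ)} (ht : t.1 ∈ A) :
    sem P (atomState ty name A) (edgeAtom ty name t) ρ =
      cl P (0, {(t.1, fun σ => if σ ∈ ty t.1 then ρ (t.2 σ) else 0)}) := by
  have h : ∃ c ∈ A, name c + 2 = name t.1 + 2 := ⟨_, ht, rfl⟩
  have hc : h.choose = t.1 := hname h.choose_spec.1 ht (by have := h.choose_spec.2; omega)
  simp only [edgeAtom, sem, atomState, Nat.add_eq_zero_iff, OfNat.ofNat_ne_zero, and_false,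
    if_false, dif_pos h, hc, show ¬ (name t.1 + 2 = 1) by omega]
  congr 4
  simp only [atomTok]
  congr 1
  funext σ
  by_cases hσ : σ ∈ ty t.1
  · rw [if_pos hσ, dif_pos hσ, dif_pos (Fin.isLt _)]
    exact congrArg (fun z => ρ (t.2 (Subtype.val z)))
      ((Finite.equivFin (ty t.1)).symm_apply_apply ⟨σ, hσ⟩)
  · simp [hσ]

theorem sem_graphFormula (hname : Set.InjOn name A) {H : HGraph ty} (hH : H.IsOver A)
    (f : H.V → ℕ) (ρ : ℕ → ℕ) :
    sem P (atomState ty name A) (graphFormula name H f) ρ = cl P (H.state fun v => ρ (f v)) := by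
  rw [graphFormula, sem_tens_map (sem_unitAtom ρ)
    (x := Sum.elim (fun v => ({ρ (f v)}, 0)) fun e => (0, {H.edgeTok (fun v => ρ (f v)) e}))]
  · congr 1
    rw [← Multiset.sum_coe, coe_map_elems, Multiset.sum_add]
    simp only [Sum.elim_inl, Sum.elim_inr]
    rw [sum_famMS_prod, sum_famMS_prod, sum_famMS_zero, sum_famMS_zero, sum_famMS_singleton,
      sum_famMS_singleton]
    exact Prod.ext (add_zero _) (zero_add _)
  · rintro (v | e) -
    · exact sem_nodeAtom ρ _
    · simp only [graphAtom, Sum.elim_inr]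
      rw [sem_edgeAtom hname ρ (hH e)]
      congr 4
      funext σ
      by_cases hσ : σ ∈ ty (H.lab e)
      · exact (if_pos hσ).trans
          ((congrArg ρ (edgeTok_snd H f e hσ)).trans (edgeTok_snd H (fun v => ρ (f v)) e hσ).symm)
      · simp [edgeTok, hσ]

end Interpretation

end Encoding

end MILL1

/-! ### The phase model of a hypergraph transformation system -/

namespace MILL1

open HGraph Formula

section Soundness

variable {Sel : Type*} {C : Type*} {ty : C → Set Sel} [∀ c, Finite (ty c)] {name : C → ℕ}
  {A : Set C}

theorem mem_sem_exGraph {P : Set (Multiset ℕ × Multiset (C × (Sel → ℕ)))}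
    (hname : Set.InjOn name A) {H : HGraph ty} (hH : H.IsOver A)
    (hinj : Function.Injective H.ext) {b : Sel → ℕ} {ρ : ℕ → ℕ} {f : H.V → ℕ}
    (hf : ∀ σ, f (H.ext σ) = ρ (b σ)) :
    H.state f ∈ sem P (atomState ty name A) (exGraph name H b) ρ := by
  obtain ⟨τ, hτ, hv⟩ := exists_valuation hinj hf
  refine mem_sem_exN (τ := τ) ?_ _ _ hτ
  rw [sem_graphFormula hname hH]
  simp only [hv]
  exact fun _ h => h

theorem sem_exGraph_subset {P : Set (Multiset ℕ × Multiset (C × (Sel → ℕ)))}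
    (hname : Set.InjOn name A) {H : HGraph ty} (hH : H.IsOver A)
    (hinj : Function.Injective H.ext) {b : Sel → ℕ} {ρ : ℕ → ℕ}
    (h : ∀ f : H.V → ℕ, (∀ σ, f (H.ext σ) = ρ (b σ)) → H.state f ∈ P) :
    sem P (atomState ty name A) (exGraph name H b) ρ ⊆ P := by
  intro m hm
  rw [← add_zero m]
  refine sem_exN_add_mem _ ρ (fun τ hτ a ha => ?_) m hm
  rw [sem_graphFormula hname hH] at ha
  refine ha 0 ?_
  rw [add_zero]
  exact h _ fun σ => by rw [extNaming_ext hinj, hτ]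

/-- The states with repeated node names, and the states of hypergraphs that can be derived in `G`
and whose external nodes are injectively named by `ε`. -/
def pole (G : HTSystem ty) (ε : Sel → ℕ) : Set (Multiset ℕ × Multiset (C × (Sel → ℕ))) :=
  {m | m.1.Nodup → Set.InjOn ε G.S.type ∧ ∃ (H : HGraph ty) (f : H.V → ℕ), (∃ n, G.DerivesIn n G.S H) ∧
    Function.Injective f ∧ H.state f = m ∧ ∀ σ, f (H.ext σ) = ε σ}

/-- If the left-hand side in a context `u` is derivable, then so is the right-hand side in `u`.
Instances of the quantifiers that repeat names are harmless, as such states lie in the pole. -/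
theorem zero_mem_sem_ruleFormula {G : HTSystem ty} (hname : Set.InjOn name (G.N ∪ G.T))
    (ε : Sel → ℕ) {r : HTRule ty} (hr : r ∈ G.P) (ρ : ℕ → ℕ) :
    0 ∈ sem (pole G ε) (atomState ty name (G.N ∪ G.T)) (ruleFormula name r) ρ := by
  refine mem_sem_allN _ _ fun τ _ a ha => ?_
  rw [sem_graphFormula hname (G.P_over r hr).2] at ha
  rw [zero_add]
  -- By closedness it suffices to test against `u`; there `a` may be replaced by the state of the
  -- right-hand side, with distinct names.
  refine sem_closed _ _ _ _ _ fun u hu => ha u fun hnd => ?_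
  set fr : r.rhs.V → ℕ := fun v => τ (Finite.equivFin r.rhs.V v)
  have hfinS : Finite G.S.type := Finite.of_injective _ G.S_inj
  -- Names from `N` on avoid all nodes, all attachments in `u` and all external names, which gives
  -- the dangling condition.
  have hfin : ({x | x ∈ (r.rhs.state fr + u).1} ∪ (⋃ t ∈ {t | t ∈ u.2}, t.2 '' ty t.1) ∪
      ε '' G.S.type).Finite :=
    ((Multiset.finite_toSet _).union ((Multiset.finite_toSet u.2).biUnion fun t _ =>
      (Set.toFinite (ty t.1)).image _)).union ((Set.toFinite G.S.type).image _)
  obtain ⟨N, hN⟩ := exists_forall_lt_of_finite hfin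
  have hb : ∀ σ h, τ (ruleBase r σ) = fr (r.rhs.ext ⟨σ, h⟩) := fun σ h => by
    rw [ruleBase_eq r σ h]
  have hfl : ∀ σ, r.lhs.extNaming (fun σ => τ (ruleBase r σ)) N (r.lhs.ext σ) =
      τ (ruleBase r σ) := extNaming_ext r.lhs_inj _ N
  have hge : ∀ v, (∀ σ, r.lhs.ext σ ≠ v) →
      N ≤ r.lhs.extNaming (fun σ => τ (ruleBase r σ)) N v := fun v hv => by
    rw [extNaming_of_forall_ne _ _ hv]
    omega
  obtain ⟨hε, H, f, ⟨n, hn⟩, hf, hst, hx⟩ := hu _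
    (mem_sem_exGraph hname (G.P_over r hr).1 r.lhs_inj hfl)
    (HTRule.nodup_extNaming hnd hb fun x hx => hN x (Or.inl (Or.inl hx)))
  have htype := hn.type_eq
  obtain ⟨H', f', hs, hf', hst', ht, hx'⟩ := HTRule.exists_step (r := r) hf hst (fr := fr)
    (fun σ h h' => by rw [hfl, hb σ h']) hnd
    (fun v hv t htu σ hσ => (lt_of_lt_of_le (hN _ (Or.inl (Or.inr
      (Set.mem_biUnion htu ⟨σ, hσ, rfl⟩)))) (hge v hv)).ne)
    (fun v hv σ => by
      rw [hx]
      exact (lt_of_lt_of_le (hN _ (Or.inr ⟨σ, htype.symm.subset σ.2, rfl⟩)) (hge v hv)).ne)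
  refine ⟨hε, H', f', ⟨n + 1, hn.step hr hs⟩, hf', hst', fun σ => ?_⟩
  rw [← hx' σ.1 (ht.symm.subset σ.2) σ.2, hx]

/-- Whatever the witnesses, the start hypergraph either has repeated names or is injectively named
and derived in zero steps. -/
theorem sem_exGraph_subset_pole {G : HTSystem ty} (hname : Set.InjOn name (G.N ∪ G.T))
    {b : Sel → ℕ} {ρ : ℕ → ℕ} :
    sem (pole G fun σ => ρ (b σ)) (atomState ty name (G.N ∪ G.T)) (exGraph name G.S b) ρ ⊆
      pole G fun σ => ρ (b σ) := by
  refine sem_exGraph_subset hname G.S_over G.S_inj fun f hf hnd => ?_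
  have hinj := nodup_famMS.1 hnd
  refine ⟨fun σ hσ σ' hσ' h => ?_, G.S, f, ⟨0, .refl (Iso.refl _)⟩, hinj, rfl, hf⟩
  have := G.S_inj (hinj ((hf ⟨σ, hσ⟩).trans (h.trans (hf ⟨σ', hσ'⟩).symm)))
  exact Subtype.mk.inj this

theorem mem_sem_tens_of_zero {P : Set (Multiset ℕ × Multiset (C × (Sel → ℕ)))}
    {I : (p : PredSymbol) → (Fin p.arity → ℕ) → Multiset ℕ × Multiset (C × (Sel → ℕ))}
    {q : Formula} {ρ : ℕ → ℕ} {m : Multiset ℕ × Multiset (C × (Sel → ℕ))}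
    (hm : m ∈ sem P I q ρ) :
    ∀ l : List Formula, (∀ B ∈ l, 0 ∈ sem P I B ρ) → m ∈ sem P I (tens q l) ρ
  | [], _ => hm
  | B :: l, h => by
    rw [← zero_add m]
    exact add_mem_sem_tensor (h B (by simp))
      (mem_sem_tens_of_zero hm l fun D hD => h D (by simp [hD]))

end Soundness

/-- The list is cut into consecutive blocks of length at most `k`. -/
theorem exists_distribution {α : Type*} (k : ℕ) :
    ∀ (n : ℕ) (l : List α), l.length ≤ k * n →
      ∃ f : Fin n → List α, (∀ i, (f i).length ≤ k) ∧ ∑ i, (f i : Multiset α) = l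
  | 0, l, h => ⟨fun _ => [], by simp, by
      have : l = [] := List.length_eq_zero_iff.1 (by simpa using h)
      simp [this]⟩
  | n + 1, l, h => by
    obtain ⟨f, hf, hl⟩ := exists_distribution k n (l.drop k) (by
      rw [List.length_drop, Nat.sub_le_iff_le_add]
      exact h)
    refine ⟨Fin.cons (l.take k) f, fun i => ?_, ?_⟩
    · refine Fin.cases ?_ (fun i => ?_) i
      · simp
      · simpa using hf i
    · rw [Fin.sum_univ_succ]
      simp only [Fin.cons_zero, Fin.cons_succ, hl]
      rw [Multiset.coe_add, List.take_append_drop]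

/-! ### States of string graphs -/

section StringGraphs

variable {Sel : Type*} {C : Type*} {ty : C → Set Sel} {s t : Sel} {T : Set C}

open Classical in
/-- The description of a hyperedge with label `c` from `x` to `y`. -/
noncomputable def arcTok (ty : C → Set Sel) (s : Sel) (c : C) (x y : ℕ) : C × (Sel → ℕ) :=
  (c, fun σ => if σ ∈ ty c then (if σ = s then x else y) else 0)

/-- A naming of the nodes of a string graph. -/
def sgNaming {w : List T} (hw : ∀ a ∈ w.map Subtype.val, ty a = {s, t})
    (x : Fin (w.length + 1) → ℕ) (v : (sg ty s t (w.map Subtype.val) hw).V) : ℕ :=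
  x (Fin.cast (by simp) (show Fin ((w.map Subtype.val).length + 1) from v))

theorem sgNaming_injective {w : List T} (hw : ∀ a ∈ w.map Subtype.val, ty a = {s, t})
    {x : Fin (w.length + 1) → ℕ} (hx : Function.Injective x) :
    Function.Injective (sgNaming hw x) :=
  fun _ _ h => Fin.cast_injective _ (hx h)

theorem sgNaming_ext {w : List T} (hw : ∀ a ∈ w.map Subtype.val, ty a = {s, t})
    (x : Fin (w.length + 1) → ℕ) (σ h) [Decidable (σ = s)] :
    sgNaming hw x ((sg ty s t (w.map Subtype.val) hw).ext ⟨σ, h⟩) =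
      if σ = s then x 0 else x (Fin.last w.length) := by
  unfold sgNaming
  simp only [sg]
  split_ifs
  · rfl
  · congr 1
    exact Fin.ext (by simp)

theorem state_sg {w : List T} (hw : ∀ a ∈ w.map Subtype.val, ty a = {s, t})
    (x : Fin (w.length + 1) → ℕ) :
    (sg ty s t (w.map Subtype.val) hw).state (sgNaming hw x) =
      (famMS x, famMS fun i : Fin w.length =>
        arcTok ty s (w.get i).1 (x i.castSucc) (x i.succ)) := by
  refine Prod.ext ?_ ?_
  · exact famMS_equiv (finCongr (by simp)) x
  · refine Eq.trans ?_ (famMS_equiv (α := (sg ty s t (w.map Subtype.val) hw).E)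
      (finCongr (by simp)) fun i : Fin w.length =>
        arcTok ty s (w.get i).1 (x i.castSucc) (x i.succ))
    refine congrArg famMS (funext fun i => ?_)
    change Fin (w.map Subtype.val).length at i
    have hl : (w.map Subtype.val).get i = (w.get (finCongr (by simp) i)).1 := by simp
    have key : ∀ x y, arcTok ty s (w.get (finCongr (by simp) i)).1 x y =
        arcTok ty s ((w.map Subtype.val).get i) x y := fun x y => by rw [hl]
    refine Eq.trans (b := arcTok ty s ((w.map Subtype.val).get i)
      (x (finCongr (by simp) i).castSucc) (x (finCongr (by simp) i).succ)) ?_ (key _ _).symm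
    refine Prod.ext rfl (funext fun σ => ?_)
    by_cases hσ : σ ∈ ty ((w.map Subtype.val).get i)
    · refine Eq.trans ?_ (if_pos hσ).symm
      refine (edgeTok_snd (sg ty s t (w.map Subtype.val) hw) _ i hσ).trans ?_
      simp only [sg, sgNaming]
      split_ifs <;> rfl
    · exact (dif_neg hσ).trans (if_neg hσ).symm

theorem arcTok_snd {c : C} {σ : Sel} (hσ : σ ∈ ty c) (x y : ℕ) [Decidable (σ = s)] :
    (arcTok ty s c x y).2 σ = if σ = s then x else y := by
  refine (if_pos hσ).trans ?_
  split_ifs <;> rfl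

/-- Each letter contributes its hyperedge and target node; only the first node is left for the start
formula to supply. -/
theorem sum_add_eq_state_sg {w : List T}
    (hw : ∀ a ∈ w.map Subtype.val, ty a = {s, t}) (x : Fin (w.length + 1) → ℕ) :
    (∑ i : Fin w.length, (({x i.succ}, {arcTok ty s (w.get i).1 (x i.castSucc) (x i.succ)}) :
      Multiset ℕ × Multiset (C × (Sel → ℕ)))) + ({x 0}, 0) =
    (sg ty s t (w.map Subtype.val) hw).state (sgNaming hw x) := by
  rw [state_sg, ← sum_famMS, sum_famMS_prod, sum_famMS_singleton, sum_famMS_singleton,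
    famMS_fin_succ]
  refine Prod.ext ?_ (add_zero _)
  exact (add_comm _ _).trans (Multiset.singleton_add _ _)

end StringGraphs

end MILL1

/-! ### The string grammar of a system and the two inclusions -/

namespace MILL1

open HGraph Formula

section StringGrammar

variable {Sel : Type*} {C : Type*} {ty : C → Set Sel} [∀ c, Finite (ty c)] {s t : Sel}

open Classical in
/-- The variables that name the external nodes of a string graph. -/
noncomputable def stBase (s σ : Sel) : ℕ := if σ = s then sVar else tVar

/-- The substitution of `x` for `s` and `y` for `t`. -/
def stSubst (x y v : ℕ) : ℕ := if v = sVar then x else if v = tVar then y else v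

theorem substST_eq (A : Formula) (x y : ℕ) : A.substST x y = A.subst (stSubst x y) := rfl

open Classical in
theorem stSubst_stBase (x y : ℕ) (σ : Sel) :
    stSubst x y (stBase s σ) = if σ = s then x else y := by
  unfold stBase
  split_ifs <;> simp [stSubst, sVar, tVar]

/-- The part of the formula of a letter that describes a hyperedge and its target. -/
noncomputable def letterBase (ty : C → Set Sel) [∀ c, Finite (ty c)] (name : C → ℕ) (s : Sel)
    (c : C) : Formula :=
  (nodeAtom tVar).tensor (edgeAtom ty name (arcTok ty s c sVar tVar))

theorem unitAtom_subst (h : ℕ → ℕ) : unitAtom.subst h = unitAtom :=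
  congrArg (Formula.atom _) (funext fun i => i.elim0)

theorem edgeAtom_arcTok_subst (name : C → ℕ) (c : C) (x y : ℕ) (h : ℕ → ℕ) :
    (edgeAtom ty name (arcTok ty s c x y)).subst h =
      edgeAtom ty name (arcTok ty s c (h x) (h y)) := by
  simp only [edgeAtom, subst]
  refine congrArg (Formula.atom _) (funext fun i => ?_)
  classical
  have hσ := ((Finite.equivFin (ty c)).symm i).2
  refine (congrArg h (arcTok_snd hσ x y)).trans (Eq.trans ?_ (arcTok_snd hσ _ _).symm)
  split_ifs <;> rfl

theorem letterBase_subst (name : C → ℕ) (c : C) (x y : ℕ) :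
    (letterBase ty name s c).subst (stSubst x y) =
      (nodeAtom y).tensor (edgeAtom ty name (arcTok ty s c x y)) := by
  rw [letterBase, subst, edgeAtom_arcTok_subst]
  rfl

theorem fvar_letterBase (name : C → ℕ) (c : C) :
    (letterBase ty name s c).fvar ⊆ {sVar, tVar} := by
  rintro v (⟨i, rfl⟩ | ⟨i, rfl⟩)
  · exact Or.inr rfl
  · classical
    refine Set.mem_of_eq_of_mem
      (arcTok_snd (s := s) ((Finite.equivFin (ty c)).symm i).2 sVar tVar) ?_
    split_ifs
    · exact Or.inl rfl
    · exact Or.inr rfl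

/-- The formula of a letter that carries a list of rules. -/
noncomputable def letterFormula (name : C → ℕ) (s : Sel) (c : C) {P : Set (HTRule ty)}
    (l : List P) : Formula :=
  tens (letterBase ty name s c) (l.map fun r => ruleFormula name r.1)

/-- The start formula. -/
noncomputable def startFormula (name : C → ℕ) (s : Sel) (S : HGraph ty) : Formula :=
  (unitAtom.tensor (nodeAtom sVar)).lolli (exGraph name S (stBase s))

/-- The string grammar of a system whose derivations are to be covered by `k` steps per letter. -/
noncomputable def grammarOf (name : C → ℕ) (G : HTSystem ty) (s t : Sel) (k : ℕ) :
    StringGrammar G.T where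
  finite_T := G.finite_T
  start := startFormula name s G.S
  start_fvar := by
    rintro x ((⟨i, -⟩ | ⟨i, rfl⟩) | hx)
    · exact i.elim0
    · exact Or.inl rfl
    · obtain ⟨σ, -, rfl⟩ := mem_fvar_exGraph name hx
      unfold stBase
      split_ifs
      · exact Or.inl rfl
      · exact Or.inr rfl
  assign := fun a A => ty a = {s, t} ∧ ∃ l : List G.P, l.length ≤ k ∧
    A = letterFormula name s a.1 l
  finite_assign := by
    have := G.finite_T.to_subtype
    have := G.finite_P.to_subtype
    refine ((Set.finite_univ (α := G.T)).prod (List.finite_length_le G.P k)).image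
      (fun p => (p.1, letterFormula name s p.1.1 p.2)) |>.subset ?_
    rintro ⟨a, A⟩ ⟨-, l, hl, h⟩
    exact ⟨(a, l), ⟨trivial, hl⟩, Prod.ext rfl h.symm⟩
  assign_fvar := by
    rintro a A ⟨-, l, -, rfl⟩ x hx
    rcases mem_fvar_tens hx with hx | ⟨B, hB, hx⟩
    · exact fvar_letterBase name _ hx
    · obtain ⟨r, -, rfl⟩ := List.mem_map.1 hB
      exact absurd hx (fvar_ruleFormula name r.1 x)

theorem subst_letterFormula (name : C → ℕ) (c : C) {P : Set (HTRule ty)} (l : List P) (x y : ℕ) :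
    (letterFormula name s c l).substST x y =
      tens ((nodeAtom y).tensor (edgeAtom ty name (arcTok ty s c x y)))
        (l.map fun r => ruleFormula name r.1) := by
  rw [substST_eq, letterFormula, subst_tens, letterBase_subst, List.map_map]
  refine congrArg _ (List.map_congr_left fun r _ => ?_)
  exact subst_eq_self _ _ fun x hx => absurd hx (fvar_ruleFormula name r.1 x)

open scoped Pointwise in
theorem mem_language_of_mem_grammarOf {name : C → ℕ} {G : HTSystem ty}
    (hname : Set.InjOn name (G.N ∪ G.T)) (hst : s ≠ t) (hS : G.S.type = {s, t}) {k : ℕ}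
    {w : List G.T} (hw : w ∈ (grammarOf name G s t k).language) :
    w ≠ [] ∧ ∃ hw : ∀ a ∈ w.map Subtype.val, ty a = {s, t},
      sg ty s t (w.map Subtype.val) hw ∈ G.language := by
  classical
  obtain ⟨A, x, hA, hx, hd⟩ := hw
  choose hty l _ hl using hA
  have hw : ∀ a ∈ w.map Subtype.val, ty a = {s, t} := by
    intro a ha
    obtain ⟨a, haw, rfl⟩ := List.mem_map.1 ha
    obtain ⟨i, rfl⟩ := List.get_of_mem haw
    exact hty i
  set ρ : ℕ → ℕ := stSubst (x 0) (x (Fin.last w.length)) with hρ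
  set P := pole G fun σ => ρ (stBase s σ)
  have hmem : ∀ i : Fin w.length,
      (({x i.succ}, {arcTok ty s (w.get i).1 (x i.castSucc) (x i.succ)}) :
        Multiset ℕ × Multiset (C × (Sel → ℕ))) ∈
      sem P (atomState ty name (G.N ∪ G.T)) ((A i).substST (x i.castSucc) (x i.succ)) id := by
    intro i
    rw [hl i, subst_letterFormula]
    refine mem_sem_tens_of_zero ?_ _ fun B hB => ?_
    · have h1 : (({x i.succ}, 0) : Multiset ℕ × Multiset (C × (Sel → ℕ))) ∈
          sem P (atomState ty name (G.N ∪ G.T)) (nodeAtom (x i.succ)) id := by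
        rw [sem_nodeAtom]; exact fun _ h => h
      have h2 : ((0, {arcTok ty s (w.get i).1 (x i.castSucc) (x i.succ)}) :
          Multiset ℕ × Multiset (C × (Sel → ℕ))) ∈ sem P (atomState ty name (G.N ∪ G.T))
          (edgeAtom ty name (arcTok ty s (w.get i).1 (x i.castSucc) (x i.succ))) id := by
        rw [sem_edgeAtom hname id (Or.inr (w.get i).2)]
        have : arcTok ty s (w.get i).1 (x i.castSucc) (x i.succ) =
            ((w.get i).1, fun σ => if σ ∈ ty (w.get i).1 then
              id ((arcTok ty s (w.get i).1 (x i.castSucc) (x i.succ)).2 σ) else 0) := by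
          refine Prod.ext rfl (funext fun σ => ?_)
          by_cases hσ : σ ∈ ty (w.get i).1
          · exact (if_pos hσ).symm
          · exact (if_neg hσ).trans (if_neg hσ).symm
        exact fun u h => by rw [this]; exact h
      have h3 := add_mem_sem_tensor h1 h2
      rwa [Prod.mk_add_mk, add_zero, zero_add] at h3
    · obtain ⟨r, -, rfl⟩ := List.mem_map.1 hB
      exact zero_mem_sem_ruleFormula hname _ r.2 _
  have hsum := hd.sound (P := P) (I := atomState ty name (G.N ∪ G.T)) id
    (∑ i : Fin w.length, ({x i.succ}, {arcTok ty s (w.get i).1 (x i.castSucc) (x i.succ)})) (by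
      rw [Multiset.map_map]
      exact Set.finsetSum_mem_finsetSum _ _ _ fun i _ => hmem i)
  rw [substST_eq, sem_subst] at hsum
  have h0 : (({x 0}, 0) : Multiset ℕ × Multiset (C × (Sel → ℕ))) ∈
      sem P (atomState ty name (G.N ∪ G.T)) (unitAtom.tensor (nodeAtom sVar)) ρ := by
    rw [sem_tensor_of_cl (sem_unitAtom ρ) (sem_nodeAtom ρ sVar), zero_add]
    exact fun _ h => h
  have hpole := sem_exGraph_subset_pole hname (hsum _ h0)
  rw [sum_add_eq_state_sg hw] at hpole
  obtain ⟨hε, H, f, ⟨n, hn⟩, -, hstate, hfx⟩ := hpole (nodup_famMS.2 (sgNaming_injective hw hx))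
  refine ⟨?_, hw, ?_, n, hn.congr_right ?_⟩
  · rintro rfl
    -- For the empty word both external nodes would get the name `x 0`, which the injectivity clause
    -- of the pole forbids.
    refine hst (hε (hS ▸ Or.inl rfl) (hS ▸ Or.inr rfl) ?_)
    simp only [hρ, stSubst_stBase]
    split_ifs <;> rfl
  · intro e
    obtain ⟨a, -, ha⟩ := List.mem_map.1 (List.get_mem (w.map Subtype.val) e)
    exact (congrArg (· ∈ G.T) ha).mp a.2
  · refine iso_of_state_eq (sgNaming_injective hw hx) hstate (hn.type_eq.symm.trans hS)
      fun σ h h' => ?_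
    rw [hfx, sgNaming_ext]
    exact stSubst_stBase _ _ _

theorem mem_grammarOf_of_derivesIn {name : C → ℕ} {G : HTSystem ty} {k n : ℕ} {w : List G.T}
    (hw : ∀ a ∈ w.map Subtype.val, ty a = {s, t})
    (hd : G.DerivesIn n G.S (sg ty s t (w.map Subtype.val) hw)) (hn : n ≤ k * w.length) :
    w ∈ (grammarOf name G s t k).language := by
  classical
  obtain ⟨l, hl, hder⟩ := derivable_of_derivesIn (b := stBase s)
    (ρ := stSubst 0 w.length) name G.S_inj hd
  obtain ⟨L, hLk, hL⟩ := exists_distribution k w.length l (hl ▸ hn)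
  refine ⟨fun i => letterFormula name s (w.get i).1 (L i), fun i => i,
    fun i => ⟨hw _ (List.mem_map_of_mem (List.get_mem w i)), L i, hLk i, rfl⟩,
    fun i j h => Fin.ext h, ?_⟩
  rw [substST_eq]
  refine Derivable.lolliR (Derivable.tensorL ?_)
  rw [unitAtom_subst]
  change Derivable (unitAtom ::ₘ nodeAtom 0 ::ₘ _) _
  simp only [subst_letterFormula]
  -- All letter formulae are unpacked at once into nodes, hyperedges and their shares of the rules.
  have key := Derivable.map_left (ι := Fin w.length)
    (F := fun i => nodeAtom i.succ ::ₘ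
      edgeAtom ty name (arcTok ty s (w.get i).1 i.castSucc i.succ) ::ₘ
      (((L i).map fun r => ruleFormula name r.1 : List Formula) : Multiset Formula))
    (A := fun i => tens ((nodeAtom i.succ).tensor
      (edgeAtom ty name (arcTok ty s (w.get i).1 i.castSucc i.succ)))
      ((L i).map fun r => ruleFormula name r.1))
    (C := (exGraph name G.S (stBase s)).subst (stSubst 0 w.length))
    (fun i Γ h => Derivable.tens_left _ (Derivable.tensorL (by
      simpa only [Multiset.cons_add] using h))) Finset.univ.val
    (unitAtom ::ₘ nodeAtom 0 ::ₘ 0)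
  rw [Multiset.add_cons, Multiset.add_cons, add_zero, Multiset.add_cons, Multiset.add_cons,
    add_zero] at key
  refine key ?_
  have h := hder (sgNaming hw fun i => i) (sgNaming_injective hw fun i j h => Fin.ext h)
    fun σ h => by rw [sgNaming_ext, stSubst_stBase]; rfl
  convert h using 2
  rw [state_sg, stateAtoms, map_famMS, map_famMS, famMS_fin_succ, ← Multiset.map_coe, ← hL]
  have hsum : ((Finset.univ : Finset (Fin w.length)).val.map fun i =>
      nodeAtom i.succ ::ₘ edgeAtom ty name (arcTok ty s (w.get i).1 i.castSucc i.succ) ::ₘ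
      (((L i).map fun r => ruleFormula name r.1 : List Formula) : Multiset Formula)).sum =
      famMS (fun i : Fin w.length => nodeAtom i.succ) +
      (famMS (fun i : Fin w.length =>
        edgeAtom ty name (arcTok ty s (w.get i).1 i.castSucc i.succ)) +
      (∑ i, (L i : Multiset G.P)).map fun r => ruleFormula name r.1) := by
    rw [← sum_famMS_singleton fun i : Fin w.length => nodeAtom i.succ,
      ← sum_famMS_singleton fun i : Fin w.length =>
        edgeAtom ty name (arcTok ty s (w.get i).1 i.castSucc i.succ), sum_famMS, sum_famMS,
      ← Multiset.coe_mapAddMonoidHom fun r : G.P => ruleFormula name r.1, map_sum,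
      ← Finset.sum_add_distrib,
      ← Finset.sum_add_distrib]
    refine Finset.sum_congr rfl fun i _ => ?_
    simp only [Multiset.coe_mapAddMonoidHom, Multiset.map_coe, Multiset.singleton_add]
  rw [hsum, Multiset.cons_add, Multiset.cons_add, add_assoc]
  rfl

end StringGrammar

/-! ### The degenerate case and the corollary -/

/-- A string grammar that generates the empty language. -/
def emptyGrammar (T : Type*) [Finite T] : StringGrammar T where
  finite_T := inferInstance
  start := unitAtom
  start_fvar := by rintro _ ⟨i, -⟩; exact i.elim0
  assign := fun _ _ => False
  finite_assign := by simp
  assign_fvar := fun _ _ h => h.elim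

theorem language_emptyGrammar (T : Type*) [Finite T] : (emptyGrammar T).language = ∅ := by
  refine Set.eq_empty_of_forall_notMem ?_
  rintro (_ | ⟨a, w⟩) ⟨A, x, hA, -, hd⟩
  · exact not_derivable_zero_atom _ _ hd
  · exact hA ⟨0, by simp⟩

end MILL1

theorem mainTheorem7 {Sel : Type*} [Countable Sel] (s t : Sel) (hst : s ≠ t)
    {C : Type*} (ty : C → Set Sel) (hty : ∀ c, (ty c).Finite)
    (G : HTSystem ty) (hG : G.IsLinearTime) :
    ∃ G' : MILL1.StringGrammar G.T,
      G'.language =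
        {w : List G.T | w ≠ [] ∧
          ∃ hw : ∀ a ∈ w.map Subtype.val, ty a = {s, t},
            HGraph.sg ty s t (w.map Subtype.val) hw ∈ G.language} := by
  have hfin : ∀ c, Finite (ty c) := fun c => (hty c).to_subtype
  have hfinT : Finite G.T := G.finite_T.to_subtype
  by_cases hS : G.S.type = {s, t}
  · obtain ⟨c, hc⟩ := hG
    obtain ⟨name, hname⟩ :=
      Set.countable_iff_exists_injOn.1 (G.finite_N.union G.finite_T).countable
    -- The string graph of `w` has size `2 * w.length + 1`, which is at most `3 * w.length` for
    -- nonempty `w`.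
    refine ⟨MILL1.grammarOf name G s t (3 * c), Set.ext fun w =>
      ⟨MILL1.mem_language_of_mem_grammarOf hname hst hS, ?_⟩⟩
    rintro ⟨hne, hw, hL⟩
    obtain ⟨n, hn, hd⟩ := hc _ hL
    refine MILL1.mem_grammarOf_of_derivesIn hw hd (hn.trans ?_)
    have hsize : (HGraph.sg ty s t (w.map Subtype.val) hw).size = w.length + 1 + w.length := by
      simp [HGraph.size, HGraph.sg]
    have hpos : 0 < w.length := List.length_pos_iff.2 hne
    rw [hsize, mul_comm 3 c, mul_assoc]
    exact Nat.mul_le_mul_left c (by omega)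
  -- Derivations preserve the type, so no string graph is derivable when the start hypergraph has
  -- another type.
  · refine ⟨MILL1.emptyGrammar G.T, ?_⟩
    rw [MILL1.language_emptyGrammar]
    refine (Set.eq_empty_of_forall_notMem ?_).symm
    rintro w ⟨-, hw, -, n, hd⟩
    exact hS hd.type_eq
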